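/- Let $\mathcal H$ be a separable (possibly finite-dimensional) complex Hilbert space, $X$ a locally compact Hausdorff space with its Borel $\sigma$-algebra, and $\mathcal S(\mathcal K)$ the set of positive trace-one operators on a Hilbert space $\mathcal K$. Let $\nu$ be a positive operator-valued measure (POVM) on $X$ with values in $\mathcal B(\mathcal H)$, that is, positive and ultraweakly countably additive; let $\rho\in\mathcal S(\mathcal H)$ be of full rank (injective), $\mu:=\nu_\rho=\operatorname{tr}(\rho\,\nu(\cdot))$, and assume that the entrywise Radon–Nikodým derivative $D=\frac{d\nu}{d\mu}$ takes values in the bounded operators. Assume also that the tensor POVM $$\nu\otimes_{\mu}\nu(E)=\int_E D\otimes D\,d\mu$$ (ultraweak integral) exists as a POVM with values in $\mathcal B(\mathcal H\otimes\mathcal H)$; its derivative with respect to $\mu$ is $D\otimes D$. For a POVM $\kappa$ on $X$ with values in $\mathcal B(\mathcal K)$ having a bounded-operator-valued derivative $\frac{d\kappa}{d\mu}$, for $s\in\mathcal S(\mathcal K)$ and $F:X\to\mathcal B(\mathcal K)$ put $$F_s(x)=\operatorname{tr}\Big(s\,\tfrac{d\kappa}{d\mu}(x)^{1/2}F(x)\tfrac{d\kappa}{d\mu}(x)^{1/2}\Big).$$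 A quantum random variable is a function $F:X\to\mathcal B(\mathcal K)$ with $x\mapsto \operatorname{tr}(sF(x))$ measurable for all $s\in\mathcal S(\mathcal K)$, and $\mathcal L_{\mathcal K}$ is the complex span of the positive quantum random variables. For $1\le p<\infty$ and $F\in\mathcal L_{\mathcal K}$ put $$\|F\|_p=\inf\Big\{\sup_{s\in\mathcal S(\mathcal K)}\big\|(F_1+F_2+F_3+F_4)_s\big\|_{L^p(\mu)}: F=F_1-F_2+iF_3-iF_4,\ 0\le F_k\in\mathcal L_{\mathcal K}\Big\},$$ $$\|F\|_{p,dec}=\inf\Big\{\max(\|S_1\|_p,\|S_2\|_p): 0\le S_1,S_2\in\mathcal L_{\mathcal K},\ \begin{bmatrix}S_1&F\\F^*&S_2\end{bmatrix}\ge0\ \mu\text{-a.e.}\Big\},$$ and let $L^p_{\mathcal K}(X,\kappa)$ consist of the $F\in\mathcal L_{\mathcal K}$ with $\|F\|_p<\infty$. Let $\mathcal S_{sep}\subset\mathcal S(\mathcal H\otimes\mathcal H)$ be the closure in $\mathcal S(\mathcal H\otimes\mathcal H)$ of the convex hull of the product states $s_1\otimes s_2$, $s_1,s_2\in\mathcal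 S(\mathcal H)$. For $F:X\to\mathcal B(\mathcal H\otimes\mathcal H)$, with $F_s$ formed with respect to $\nu\otimes_\mu\nu$, put $$\|F\|_{1,sep,\nu\otimes_\mu\nu}=\sup_{s\in\mathcal S_{sep}}\|F_s\|_{L^1(\mu)},$$ $$\|F\|_{1,sep,dec}=\inf\Big\{\max_i\|S_i\|_{1,sep,\nu\otimes_\mu\nu}: 0\le S_1,S_2\in\mathcal L_{\mathcal H\otimes\mathcal H},\ \begin{bmatrix}S_1&F\\F^*&S_2\end{bmatrix}\ge0\ \mu\text{-a.e.}\Big\}.$$ **Theorem.** Let $1<p,q<\infty$ with $\frac1p+\frac1q=1$, let $f\in L^p_{\mathcal H}(X,\nu)$, $g\in L^q_{\mathcal H}(X,\nu)$, and let $(f\otimes g)(x)=f(x)\otimes g(x)$. Then $$\|f\otimes g\|_{1,sep,\nu\otimes_{\nu_\rho}\nu}\le\|f\|_p\,\|g\|_q\qquad\text{and}\qquad \|f\otimes g\|_{1,sep,dec}\le\|f\|_{p,dec}\,\|g\|_{q,dec}.$$ If $\mathcal H$ is finite-dimensional, the second inequality also holds when $S_1,S_2$ in the definition of $\|\cdot\|_{1,sep,dec}$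 are restricted to $L^1_{\mathcal H\otimes\mathcal H}(X,\nu\otimes_{\nu_\rho}\nu)$. -/

import Mathlib

open MeasureTheory
open scoped TensorProduct ENNReal ComplexOrder

noncomputable section

namespace QRV

section Trace

variable {K : Type*} [NormedAddCommGroup K] [InnerProductSpace ℂ K] [CompleteSpace K]

/-- Index set of a fixed orthonormal (Hilbert) basis of `K`. -/
def onbIndex (K : Type*) [NormedAddCommGroup K] [InnerProductSpace ℂ K] [CompleteSpace K] :
    Set K :=
  (exists_hilbertBasis ℂ K).choose

/-- A fixed orthonormal (Hilbert) basis of `K`. -/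
def onb (K : Type*) [NormedAddCommGroup K] [InnerProductSpace ℂ K] [CompleteSpace K] :
    HilbertBasis (onbIndex K) ℂ K :=
  (exists_hilbertBasis ℂ K).choose_spec.choose

/-- The trace `∑ i, ⟨e i, T (e i)⟩`. It is only used for operators `T = s * A` with `s` a density
operator, for which the sum converges absolutely and does not depend on the basis. -/
def tr (T : K →L[ℂ] K) : ℂ :=
  ∑' i, inner ℂ (onb K i) (T (onb K i))

/-- States (density operators): positive operators of trace one. -/
def IsState (s : K →L[ℂ] K) : Prop :=
  0 ≤ s ∧ HasSum (fun i => inner ℂ (onb K i) (s (onb K i))) 1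

theorem hasSum_norm_inner_sq (x : K) :
    HasSum (fun i => ‖inner ℂ (onb K i) x‖ ^ 2) (‖x‖ ^ 2) := by
  have h := Complex.hasSum_re ((onb K).hasSum_inner_mul_inner x x)
  have e : ∀ i, (inner ℂ x (onb K i) * inner ℂ (onb K i) x : ℂ).re
      = ‖inner ℂ (onb K i) x‖ ^ 2 := by
    intro i
    rw [← inner_conj_symm x (onb K i), Complex.conj_mul']
    norm_cast
  have e2 : (inner ℂ x x : ℂ).re = ‖x‖ ^ 2 := by
    rw [inner_self_eq_norm_sq_to_K]; norm_cast
  rw [e2] at h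
  simpa only [e] using h

/-- `tr (s A) ≥ 0` for a state `s` and a positive operator `A`. -/
theorem tr_state_mul_nonneg {s A : K →L[ℂ] K} (hs : IsState s) (hA : 0 ≤ A) :
    0 ≤ (tr (s * A)).re := by
  set b := onb K
  set R : K →L[ℂ] K := CFC.sqrt s with hR
  have hR0 : 0 ≤ R := CFC.sqrt_nonneg s
  have hRR : R * R = s := CFC.sqrt_mul_sqrt_self s hs.1
  have hRsymm : ∀ x y, inner ℂ (R x) y = inner ℂ x (R y) := fun x y =>
    ((ContinuousLinearMap.nonneg_iff_isPositive R).1 hR0).isSymmetric x y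
  have hAsymm : ∀ x y, inner ℂ (A x) y = inner ℂ x (A y) := fun x y =>
    ((ContinuousLinearMap.nonneg_iff_isPositive A).1 hA).isSymmetric x y
  have hsR : ∀ x, s x = R (R x) := fun x => by rw [← hRR]; rfl
  have hsumR : Summable fun i => ‖R (b i)‖ ^ 2 := by
    have h := (Complex.hasSum_re hs.2).summable
    refine h.congr fun i => ?_
    rw [hsR, ← hRsymm, inner_self_eq_norm_sq_to_K]
    norm_cast
  set φ : onbIndex K × onbIndex K → ℂ := fun q =>
    inner ℂ (R (b q.1)) (b q.2) * inner ℂ (b q.2) (R (A (b q.1))) with hφ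
  have h1 : Summable fun q : onbIndex K × onbIndex K => ‖inner ℂ (b q.2) (R (b q.1))‖ ^ 2 := by
    refine (summable_prod_of_nonneg fun _ => by positivity).2 ⟨fun i => ?_, ?_⟩
    · exact (hasSum_norm_inner_sq (R (b i))).summable
    · refine hsumR.congr fun i => ?_
      exact (hasSum_norm_inner_sq (R (b i))).tsum_eq.symm
  have h2 : Summable fun q : onbIndex K × onbIndex K =>
      ‖inner ℂ (b q.2) (A (R (b q.1)))‖ ^ 2 := by
    refine (summable_prod_of_nonneg fun _ => by positivity).2 ⟨fun i => ?_, ?_⟩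
    · exact (hasSum_norm_inner_sq (A (R (b i)))).summable
    · have : ∀ i, ∑' j, ‖inner ℂ (b j) (A (R (b i)))‖ ^ 2 = ‖A (R (b i))‖ ^ 2 :=
        fun i => (hasSum_norm_inner_sq (A (R (b i)))).tsum_eq
      simp only [this]
      refine Summable.of_nonneg_of_le (fun _ => by positivity) (fun i => ?_)
        (hsumR.mul_left (‖A‖ ^ 2))
      rw [← mul_pow]
      gcongr
      exact A.le_opNorm _
  have e1 : ∀ i j, inner ℂ (b j) (R (A (b i))) = inner ℂ (A (R (b j))) (b i) := fun i j => by
    rw [← hRsymm, ← hAsymm]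
  have hφs : Summable φ := by
    refine Summable.of_norm_bounded (h1.add h2.prod_symm) fun q => ?_
    simp only [hφ, Prod.fst_swap, Prod.snd_swap, norm_mul]
    rw [e1, norm_inner_symm (R (b q.1)), norm_inner_symm (A (R (b q.2)))]
    nlinarith [sq_nonneg (‖inner ℂ (b q.2) (R (b q.1))‖ - ‖inner ℂ (b q.1) (A (R (b q.2)))‖),
      sq_nonneg (‖inner ℂ (b q.2) (R (b q.1))‖), sq_nonneg (‖inner ℂ (b q.1) (A (R (b q.2)))‖)]
  have etr : tr (s * A) = ∑' i, ∑' j, φ (i, j) := by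
    unfold tr
    refine tsum_congr fun i => ?_
    rw [mul_apply_eq_comp, hsR, ← hRsymm]
    exact (b.tsum_inner_mul_inner (R (b i)) (R (A (b i)))).symm
  have eswap : ∀ j, ∑' i, φ (i, j) = inner ℂ (A (R (b j))) (R (b j)) := fun j => by
    rw [← b.tsum_inner_mul_inner]
    refine tsum_congr fun i => ?_
    simp only [hφ]
    rw [e1, hRsymm, mul_comm]
  have hcomm : ∑' i, ∑' j, φ (i, j) = ∑' j, ∑' i, φ (i, j) :=
    Summable.tsum_comm (f := fun j i => φ (i, j)) hφs.prod_symm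
  have hsum : Summable fun j => ∑' i, φ (i, j) := hφs.prod_symm.prod
  rw [etr, hcomm, Complex.re_tsum hsum]
  refine tsum_nonneg fun j => ?_
  rw [eswap]
  exact ((ContinuousLinearMap.nonneg_iff_isPositive A).1 hA).re_inner_nonneg_left _

end Trace

/-- A positive operator-valued measure on the measurable subsets of `X`: positive and ultraweakly
countably additive. The values on non-measurable sets are irrelevant. -/
structure POVM (X : Type*) [MeasurableSpace X] (K : Type*) [NormedAddCommGroup K]
    [InnerProductSpace ℂ K] [CompleteSpace K] where
  toFun : Set X → (K →L[ℂ] K)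
  nonneg : ∀ E, MeasurableSet E → 0 ≤ toFun E
  hasSum_iUnion : ∀ E : ℕ → Set X, (∀ k, MeasurableSet (E k)) →
    Pairwise (Function.onFun Disjoint E) → ∀ s : K →L[ℂ] K, IsState s →
      HasSum (fun k => tr (s * toFun (E k))) (tr (s * toFun (⋃ k, E k)))

section General

variable {X : Type*} [MeasurableSpace X]
variable {K : Type*} [NormedAddCommGroup K] [InnerProductSpace ℂ K] [CompleteSpace K]

theorem POVM.tr_empty (ν : POVM X K) {s : K →L[ℂ] K} (hs : IsState s) :
    tr (s * ν.toFun ∅) = 0 := by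
  have h := ν.hasSum_iUnion (fun _ => ∅) (fun _ => MeasurableSet.empty)
    (fun _ _ _ => by simp [Function.onFun]) s hs
  exact (summable_const_iff (β := ℕ) _).1 h.summable

/-- The finite positive measure `ν_ρ(E) = tr (ρ ν(E))`. -/
def POVM.scalarMeasure (ν : POVM X K) (ρ : K →L[ℂ] K) (hρ : IsState ρ) : Measure X :=
  Measure.ofMeasurable (fun E _ => ENNReal.ofReal (tr (ρ * ν.toFun E)).re)
    (by simp [ν.tr_empty hρ])
    (by
      intro E hE hd
      have h := Complex.hasSum_re (ν.hasSum_iUnion E hE hd ρ hρ)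
      rw [← h.tsum_eq]
      exact ENNReal.ofReal_tsum_of_nonneg
        (fun k => tr_state_mul_nonneg hρ (ν.nonneg _ (hE k))) h.summable)

theorem POVM.scalarMeasure_apply (ν : POVM X K) (ρ : K →L[ℂ] K) (hρ : IsState ρ) {E : Set X}
    (hE : MeasurableSet E) :
    ν.scalarMeasure ρ hρ E = ENNReal.ofReal (tr (ρ * ν.toFun E)).re :=
  Measure.ofMeasurable_apply E hE

/-- Quantum random variables: `x ↦ tr (s f(x))` is measurable for every state `s`. -/
def IsQRV (f : X → (K →L[ℂ] K)) : Prop :=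
  ∀ s : K →L[ℂ] K, IsState s → Measurable fun x => tr (s * f x)

/-- The space `𝓛_K(X)`: the complex span of the positive quantum random variables. -/
def qrvSpan (X : Type*) [MeasurableSpace X] (K : Type*) [NormedAddCommGroup K]
    [InnerProductSpace ℂ K] [CompleteSpace K] : Submodule ℂ (X → (K →L[ℂ] K)) :=
  Submodule.span ℂ {f | IsQRV f ∧ ∀ x, 0 ≤ f x}

/-- `D` is a version of the Radon-Nikodym derivative `dν/dμ`: a quantum random variable whose
matrix entries are the densities of the matrix entries of `ν`. -/
def IsRNDeriv (ν : POVM X K) (μ : Measure X) (D : X → (K →L[ℂ] K)) : Prop :=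
  IsQRV D ∧ ∀ i j, Integrable (fun x => inner ℂ (onb K i) (D x (onb K j))) μ ∧
    ∀ E, MeasurableSet E → inner ℂ (onb K i) (ν.toFun E (onb K j)) =
      ∫ x in E, inner ℂ (onb K i) (D x (onb K j)) ∂μ

/-- `ν` has a Radon-Nikodym derivative with respect to `μ` with values in the bounded operators. -/
def HasRNDeriv (ν : POVM X K) (μ : Measure X) : Prop :=
  ∃ D : X → (K →L[ℂ] K), IsRNDeriv ν μ D

open Classical in
/-- The Radon-Nikodym derivative `dν/dμ` (and `0` if there is none with bounded values). -/
def rnDeriv (ν : POVM X K) (μ : Measure X) : X → (K →L[ℂ] K) :=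
  if h : HasRNDeriv ν μ then h.choose else 0

/-- `f_s(x) = tr (s (dν/dμ)(x)^{1/2} f(x) (dν/dμ)(x)^{1/2})`. -/
def stateFun (ν : POVM X K) (μ : Measure X) (s : K →L[ℂ] K) (f : X → (K →L[ℂ] K)) (x : X) : ℂ :=
  tr (s * (CFC.sqrt (rnDeriv ν μ x) * f x * CFC.sqrt (rnDeriv ν μ x)))

/-- The set `Pos_f` of 4-tuples of positive elements of `𝓛_K(X)` with
`f = f₁ - f₂ + i f₃ - i f₄`. -/
def posDecomp (f : X → (K →L[ℂ] K)) : Set (Fin 4 → X → (K →L[ℂ] K)) :=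
  {F | (∀ k, F k ∈ qrvSpan X K) ∧ (∀ k x, 0 ≤ F k x) ∧
    f = F 0 - F 1 + Complex.I • F 2 - Complex.I • F 3}

/-- The norm `‖f‖_p`, with values in `[0, ∞]`. -/
def pNorm (ν : POVM X K) (μ : Measure X) (p : ℝ) (f : X → (K →L[ℂ] K)) : ℝ≥0∞ :=
  ⨅ F ∈ posDecomp f, ⨆ (s : K →L[ℂ] K) (_ : IsState s),
    eLpNorm (stateFun ν μ s (F 0 + F 1 + F 2 + F 3)) (ENNReal.ofReal p) μ

/-- The space `𝓛^p_K(X, ν)`. -/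
def lpSpace (ν : POVM X K) (μ : Measure X) (p : ℝ) : Set (X → (K →L[ℂ] K)) :=
  {f | f ∈ qrvSpan X K ∧ pNorm ν μ p f < ∞}

/-- Positivity of the operator matrix `[[S, T], [T*, R]]` on `K ⊕ K`. -/
def BlockPos (S T R : K →L[ℂ] K) : Prop :=
  ∀ u v : K, 0 ≤ inner ℂ u (S u + T v) + inner ℂ v (ContinuousLinearMap.adjoint T u + R v)

/-- The decomposable norm `‖f‖_{p,dec}`. -/
def decNorm (ν : POVM X K) (μ : Measure X) (p : ℝ) (f : X → (K →L[ℂ] K)) : ℝ≥0∞ :=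
  ⨅ (S : X → (K →L[ℂ] K)) (R : X → (K →L[ℂ] K))
    (_ : S ∈ qrvSpan X K ∧ R ∈ qrvSpan X K ∧ (∀ x, 0 ≤ S x) ∧ (∀ x, 0 ≤ R x) ∧
      ∀ᵐ x ∂μ, BlockPos (S x) (f x) (R x)),
    max (pNorm ν μ p S) (pNorm ν μ p R)

end General

section Tensor

variable {X : Type*} [MeasurableSpace X]
variable {H₁ : Type*} [NormedAddCommGroup H₁] [InnerProductSpace ℂ H₁] [CompleteSpace H₁]
variable {H₂ : Type*} [NormedAddCommGroup H₂] [InnerProductSpace ℂ H₂] [CompleteSpace H₂]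

/-- The Hilbert space tensor product. -/
abbrev HTensor (H₁ : Type*) [NormedAddCommGroup H₁] [InnerProductSpace ℂ H₁]
    (H₂ : Type*) [NormedAddCommGroup H₂] [InnerProductSpace ℂ H₂] : Type _ :=
  UniformSpace.Completion (H₁ ⊗[ℂ] H₂)

/-- The tensor product of two bounded operators, as an operator on the Hilbert space tensor
product. -/
def opTensor (A : H₁ →L[ℂ] H₁) (B : H₂ →L[ℂ] H₂) : HTensor H₁ H₂ →L[ℂ] HTensor H₁ H₂ :=
  (TensorProduct.mapL A B).completion

/-- The pointwise tensor product of operator-valued functions. -/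
def funTensor (f : X → (H₁ →L[ℂ] H₁)) (g : X → (H₂ →L[ℂ] H₂)) :
    X → (HTensor H₁ H₂ →L[ℂ] HTensor H₁ H₂) :=
  fun x => opTensor (f x) (g x)

/-- `ν` is the tensor product `ν₁ ⊗_μ ν₂`, i.e.
`ν(E) = ∫_E (dν₁/dμ ⊗ dν₂/dμ) dμ` as an ultraweak integral. -/
def IsTensorPOVM (μ : Measure X) (ν₁ : POVM X H₁) (ν₂ : POVM X H₂) (ν : POVM X (HTensor H₁ H₂)) :
    Prop :=
  ∀ s : HTensor H₁ H₂ →L[ℂ] HTensor H₁ H₂, IsState s →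
    Integrable (fun x => tr (s * opTensor (rnDeriv ν₁ μ x) (rnDeriv ν₂ μ x))) μ ∧
    ∀ E, MeasurableSet E → tr (s * ν.toFun E) =
      ∫ x in E, tr (s * opTensor (rnDeriv ν₁ μ x) (rnDeriv ν₂ μ x)) ∂μ

/-- Separable states: the closure, within the states, of the convex hull of the product states.
On the set of density operators the operator norm, the trace norm and the ultraweak topology
coincide, so it does not matter in which of them the closure is taken. -/
def sepStates (H₁ : Type*) [NormedAddCommGroup H₁] [InnerProductSpace ℂ H₁] [CompleteSpace H₁]
    (H₂ : Type*) [NormedAddCommGroup H₂] [InnerProductSpace ℂ H₂] [CompleteSpace H₂] :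
    Set (HTensor H₁ H₂ →L[ℂ] HTensor H₁ H₂) :=
  {s | IsState s ∧ s ∈ closure (convexHull ℝ {t | ∃ (s₁ : H₁ →L[ℂ] H₁) (s₂ : H₂ →L[ℂ] H₂),
    IsState s₁ ∧ IsState s₂ ∧ t = opTensor s₁ s₂})}

/-- The seminorm `‖F‖_{p,sep,ν}`, where `ν` is a POVM on the tensor product and `μ` the reference
measure. -/
def sepNorm (ν : POVM X (HTensor H₁ H₂)) (μ : Measure X) (p : ℝ)
    (F : X → (HTensor H₁ H₂ →L[ℂ] HTensor H₁ H₂)) : ℝ≥0∞ :=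
  ⨆ s ∈ sepStates H₁ H₂, eLpNorm (stateFun ν μ s F) (ENNReal.ofReal p) μ

/-- The decomposable version `‖F‖_{p,sep,dec}`, where the majorants `S, R` range over the positive
functions in the class `C`. -/
def sepDecNorm (C : Set (X → (HTensor H₁ H₂ →L[ℂ] HTensor H₁ H₂)))
    (ν : POVM X (HTensor H₁ H₂)) (μ : Measure X) (p : ℝ)
    (F : X → (HTensor H₁ H₂ →L[ℂ] HTensor H₁ H₂)) : ℝ≥0∞ :=
  ⨅ (S : X → (HTensor H₁ H₂ →L[ℂ] HTensor H₁ H₂)) (R : X → (HTensor H₁ H₂ →L[ℂ] HTensor H₁ H₂))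
    (_ : S ∈ C ∧ R ∈ C ∧ (∀ x, 0 ≤ S x) ∧ (∀ x, 0 ≤ R x) ∧
      ∀ᵐ x ∂μ, BlockPos (S x) (F x) (R x)),
    max (sepNorm ν μ p S) (sepNorm ν μ p R)

end Tensor

end QRV

end

/-!
Put `f_s(x) = tr (s D(x)^{1/2} f(x) D(x)^{1/2})` with `D = dν/dμ`. By uniqueness of positive square
roots the square root of `D₁ ⊗ D₂` is the tensor product of the square roots, so
`(f ⊗ g)_{s ⊗ t} = f_s g_t` almost everywhere, and Hölder's inequality bounds the norm of this
product. Since `s ↦ f_s(x)` is affine and weakly continuous on states, convexity of the `L^r` norm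
and Fatou's lemma carry the bound from product states to the closure of their convex hull.

For the decomposable norms, the point is that operator matrices `[[S, f], [f*, R]] ≥ 0` may be
tensored entrywise. Positivity of such a matrix means that its Gram matrices against finite families
of vectors are positive semidefinite; against families of simple tensors, the Gram matrix of the
tensored matrix is the Schur product of two such Gram matrices, hence positive semidefinite by
Schur's theorem. In finite dimension the operator norm of a positive operator is at most its trace,
a finite sum of expectations in pure states, so `S ⊗ T` has finite norm against every state and not
only against the separable ones.
-/

noncomputable section

namespace QRV

open scoped InnerProduct InnerProductSpace

/-! ### Hilbert–Schmidt sums -/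

section HilbertSchmidt

variable {𝕜 E F ι κ : Type*} [RCLike 𝕜] [NormedAddCommGroup E] [InnerProductSpace 𝕜 E]
  [NormedAddCommGroup F] [InnerProductSpace 𝕜 F]

theorem hasSum_sq_norm_inner (b : HilbertBasis ι 𝕜 E) (x : E) :
    HasSum (fun i => ‖⟪b i, x⟫_𝕜‖ ^ 2) (‖x‖ ^ 2) := by
  have h := b.hasSum_inner_mul_inner x x
  simp only [inner_self_eq_norm_sq_to_K, ← inner_conj_symm x,
    RCLike.conj_mul] at h
  exact_mod_cast h

theorem countable_of_orthonormal [TopologicalSpace.SeparableSpace E] {v : ι → E}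
    (hv : Orthonormal 𝕜 v) : Countable ι := by
  refine Pairwise.countable_of_isOpen_disjoint (s := fun i => Metric.ball (v i) (1 / 2))
    (fun i j hij => Metric.ball_disjoint_ball ?_) (fun _ => Metric.isOpen_ball)
    fun i => ⟨v i, Metric.mem_ball_self (by norm_num)⟩
  have h := norm_sub_sq (𝕜 := 𝕜) (v i) (v j)
  rw [hv.2 hij, hv.1 i, hv.1 j, map_zero] at h
  rw [dist_eq_norm]
  nlinarith [norm_nonneg (v i - v j)]

theorem summable_sq_norm_inner_prod (b : HilbertBasis ι 𝕜 E) {v : κ → E}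
    (hv : Summable fun k => ‖v k‖ ^ 2) :
    Summable fun q : κ × ι => ‖⟪b q.2, v q.1⟫_𝕜‖ ^ 2 :=
  (summable_prod_of_nonneg fun _ => by positivity).2
    ⟨fun k => (hasSum_sq_norm_inner b (v k)).summable,
      hv.congr fun k => (hasSum_sq_norm_inner b (v k)).tsum_eq.symm⟩

variable [CompleteSpace E] [CompleteSpace F]

theorem exists_hasSum_inner_and_adjoint (b : HilbertBasis ι 𝕜 E) (b' : HilbertBasis κ 𝕜 F)
    {B C : E →L[𝕜] F} (hB : Summable fun i => ‖B (b i)‖ ^ 2)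
    (hC : Summable fun i => ‖C (b i)‖ ^ 2) :
    ∃ c : 𝕜, HasSum (fun i => ⟪B (b i), C (b i)⟫_𝕜) c ∧
      HasSum (fun j => ⟪(C†) (b' j), (B†) (b' j)⟫_𝕜) c := by
  have hsum : Summable fun q : ι × κ => ⟪B (b q.1), b' q.2⟫_𝕜 * ⟪b' q.2, C (b q.1)⟫_𝕜 := by
    refine .of_norm_bounded ((summable_sq_norm_inner_prod b' hB).add
      (summable_sq_norm_inner_prod b' hC)) fun q => ?_
    rw [norm_mul, norm_inner_symm]
    nlinarith [two_mul_le_add_sq ‖⟪b' q.2, B (b q.1)⟫_𝕜‖ ‖⟪b' q.2, C (b q.1)⟫_𝕜‖,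
      norm_nonneg ⟪b' q.2, B (b q.1)⟫_𝕜, norm_nonneg ⟪b' q.2, C (b q.1)⟫_𝕜]
  obtain ⟨c, hc⟩ := hsum
  refine ⟨c, hc.prod_fiberwise fun i => b'.hasSum_inner_mul_inner _ _, ?_⟩
  refine ((Equiv.prodComm κ ι).hasSum_iff.2 hc).prod_fiberwise fun j => ?_
  convert b.hasSum_inner_mul_inner ((C†) (b' j)) ((B†) (b' j)) using 2 with i
  simp [ContinuousLinearMap.adjoint_inner_left, ContinuousLinearMap.adjoint_inner_right, mul_comm]

theorem hasSum_sq_norm_adjoint (b : HilbertBasis ι 𝕜 E) (b' : HilbertBasis κ 𝕜 F)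
    {B : E →L[𝕜] F} {c : ℝ} (hB : HasSum (fun i => ‖B (b i)‖ ^ 2) c) :
    HasSum (fun j => ‖(B†) (b' j)‖ ^ 2) c := by
  obtain ⟨d, hd, hd'⟩ := exists_hasSum_inner_and_adjoint b b' hB.summable hB.summable
  simp only [inner_self_eq_norm_sq_to_K] at hd hd'
  obtain rfl : (c : 𝕜) = d := HasSum.unique (by exact_mod_cast hB) hd
  exact_mod_cast hd'

theorem sq_norm_le_of_hasSum (b : HilbertBasis ι 𝕜 E) {B : E →L[𝕜] F} {c : ℝ}
    (hB : HasSum (fun i => ‖B (b i)‖ ^ 2) c) : ‖B‖ ^ 2 ≤ c := by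
  have hc : 0 ≤ c := hB.nonneg fun _ => by positivity
  suffices ‖B†‖ ≤ √c by
    rw [LinearIsometryEquiv.norm_map] at this
    exact (Real.le_sqrt (norm_nonneg B) hc).1 this
  refine ContinuousLinearMap.opNorm_le_bound _ (Real.sqrt_nonneg c) fun y => ?_
  refine (sq_le_sq₀ (norm_nonneg _) (by positivity)).1 ?_
  rw [mul_pow, Real.sq_sqrt hc]
  refine hasSum_le (fun i => ?_) (hasSum_sq_norm_inner b ((B†) y)) (hB.mul_right (‖y‖ ^ 2))
  rw [ContinuousLinearMap.adjoint_inner_right, ← mul_pow]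
  gcongr
  exact norm_inner_le_norm _ _

instance {K : Type*} [NormedAddCommGroup K] [InnerProductSpace ℂ K] [CompleteSpace K]
    [TopologicalSpace.SeparableSpace K] : Countable (onbIndex K) :=
  countable_of_orthonormal (onb K).orthonormal

end HilbertSchmidt

/-! ### States and their expectation values -/

section States

variable {K : Type*} [NormedAddCommGroup K] [InnerProductSpace ℂ K] {ι κ : Type*}

theorem nonneg_iff_forall_inner_nonneg {A : K →L[ℂ] K} : 0 ≤ A ↔ ∀ x, 0 ≤ ⟪x, A x⟫_ℂ := by
  refine ⟨fun h => ((ContinuousLinearMap.nonneg_iff_isPositive A).1 h).inner_nonneg_right,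
    fun h => (ContinuousLinearMap.nonneg_iff_isPositive A).2 ?_⟩
  refine (ContinuousLinearMap.isPositive_iff_complex A).2 fun x => ?_
  have hx : 0 ≤ ⟪A x, x⟫_ℂ := by
    rw [← inner_conj_symm, (IsSelfAdjoint.of_nonneg (h x)).conj_eq]
    exact h x
  obtain ⟨hre, him⟩ := Complex.nonneg_iff.1 hx
  exact ⟨Complex.ext rfl him, hre⟩

theorem nonneg_of_dense {A : K →L[ℂ] K} {Q : Set K} (hQ : Dense Q)
    (h : ∀ u ∈ Q, 0 ≤ ⟪u, A u⟫_ℂ) : 0 ≤ A :=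
  nonneg_iff_forall_inner_nonneg.2 fun x => by
    have hclosed : IsClosed {x : K | 0 ≤ ⟪x, A x⟫_ℂ} :=
      isClosed_le continuous_const (continuous_id.inner A.continuous)
    exact hclosed.closure_subset_iff.2 h (hQ x)

theorem inner_map_of_nonneg {A : K →L[ℂ] K} (hA : 0 ≤ A) (x y : K) :
    ⟪A x, y⟫_ℂ = ⟪x, A y⟫_ℂ :=
  ((ContinuousLinearMap.nonneg_iff_isPositive A).1 hA).inner_left_eq_inner_right x y

variable [CompleteSpace K]

theorem inner_apply_polarization (A : K →L[ℂ] K) (u v : K) : ⟪u, A v⟫_ℂ =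
    (⟪u + v, A (u + v)⟫_ℂ - ⟪u - v, A (u - v)⟫_ℂ -
      Complex.I * ⟪u + Complex.I • v, A (u + Complex.I • v)⟫_ℂ +
      Complex.I * ⟪u - Complex.I • v, A (u - Complex.I • v)⟫_ℂ) / 4 := by
  simpa only [ContinuousLinearMap.coe_coe, ContinuousLinearMap.adjoint_inner_left] using
    inner_map_polarization' (A†).toLinearMap u v

theorem adjoint_eq_self_of_nonneg {A : K →L[ℂ] K} (hA : 0 ≤ A) : A† = A :=
  (IsSelfAdjoint.of_nonneg hA).star_eq

theorem inner_map_eq_inner_sqrt {A : K →L[ℂ] K} (hA : 0 ≤ A) (x y : K) :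
    ⟪x, A y⟫_ℂ = ⟪CFC.sqrt A x, CFC.sqrt A y⟫_ℂ := by
  rw [inner_map_of_nonneg (CFC.sqrt_nonneg A), ← mul_apply_eq_comp, CFC.sqrt_mul_sqrt_self A hA]

theorem inner_map_self_eq_sq_norm_sqrt {A : K →L[ℂ] K} (hA : 0 ≤ A) (x : K) :
    ⟪x, A x⟫_ℂ = ↑(‖CFC.sqrt A x‖ ^ 2) := by
  rw [inner_map_eq_inner_sqrt hA, inner_self_eq_norm_sq_to_K]
  norm_cast

theorem adjoint_mul_self_nonneg (A : K →L[ℂ] K) : 0 ≤ A† * A :=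
  star_mul_self_nonneg A

theorem norm_le_of_hasSum_inner {A : K →L[ℂ] K} (hA : 0 ≤ A) (b : HilbertBasis ι ℂ K) {c : ℝ}
    (h : HasSum (fun i => ⟪b i, A (b i)⟫_ℂ) c) : ‖A‖ ≤ c := by
  simp only [inner_map_self_eq_sq_norm_sqrt hA, Complex.hasSum_ofReal] at h
  calc ‖A‖ = ‖CFC.sqrt A * CFC.sqrt A‖ := by rw [CFC.sqrt_mul_sqrt_self A hA]
    _ ≤ ‖CFC.sqrt A‖ ^ 2 := (norm_mul_le _ _).trans_eq (sq _).symm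
    _ ≤ c := sq_norm_le_of_hasSum b h

theorem hasSum_inner_of_nonneg {A : K →L[ℂ] K} (hA : 0 ≤ A) (b : HilbertBasis ι ℂ K)
    (b' : HilbertBasis κ ℂ K) {c : ℂ} (h : HasSum (fun i => ⟪b i, A (b i)⟫_ℂ) c) :
    HasSum (fun j => ⟪b' j, A (b' j)⟫_ℂ) c := by
  have hsum : Summable fun i => ‖CFC.sqrt A (b i)‖ ^ 2 := by
    simpa only [inner_map_self_eq_sq_norm_sqrt hA, Complex.ofReal_re] using
      (Complex.hasSum_re h).summable
  obtain ⟨d, hd, hd'⟩ := exists_hasSum_inner_and_adjoint b b' hsum hsum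
  simp only [adjoint_eq_self_of_nonneg (CFC.sqrt_nonneg A), ← inner_map_eq_inner_sqrt hA] at hd hd'
  rwa [h.unique hd]

theorem isState_of_hasSum_inner {A : K →L[ℂ] K} (hA : 0 ≤ A) (b : HilbertBasis ι ℂ K)
    (h : HasSum (fun i => ⟪b i, A (b i)⟫_ℂ) 1) : IsState A :=
  ⟨hA, hasSum_inner_of_nonneg hA b (onb K) h⟩

variable {s t : K →L[ℂ] K}

theorem IsState.hasSum_sq_norm_sqrt (hs : IsState s) (b : HilbertBasis ι ℂ K) :
    HasSum (fun i => ‖CFC.sqrt s (b i)‖ ^ 2) 1 := by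
  have h := hasSum_inner_of_nonneg hs.1 (onb K) b hs.2
  rw [← Complex.ofReal_one] at h
  simpa only [inner_map_self_eq_sq_norm_sqrt hs.1, Complex.hasSum_ofReal] using h

theorem IsState.exists_hasSum_inner (hs : IsState s) (A : K →L[ℂ] K)
    (b : HilbertBasis ι ℂ K) (b' : HilbertBasis κ ℂ K) :
    ∃ c : ℂ, HasSum (fun i => ⟪CFC.sqrt s (b i), A (CFC.sqrt s (b i))⟫_ℂ) c ∧
      HasSum (fun j => ⟪b' j, s (A (b' j))⟫_ℂ) c := by
  have hs_sum := (hs.hasSum_sq_norm_sqrt b).summable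
  have hAs_sum : Summable fun i => ‖(A† ∘L CFC.sqrt s) (b i)‖ ^ 2 := by
    refine .of_nonneg_of_le (fun _ => by positivity) (fun i => ?_) (hs_sum.mul_left (‖A†‖ ^ 2))
    rw [← mul_pow]
    gcongr
    exact (A†).le_opNorm _
  have hadj : (A† ∘L CFC.sqrt s)† = CFC.sqrt s ∘L A := by
    rw [ContinuousLinearMap.adjoint_comp, ContinuousLinearMap.adjoint_adjoint,
      adjoint_eq_self_of_nonneg (CFC.sqrt_nonneg s)]
  obtain ⟨c, hc, hc'⟩ := exists_hasSum_inner_and_adjoint b b' hAs_sum hs_sum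
  simp only [hadj, adjoint_eq_self_of_nonneg (CFC.sqrt_nonneg s),
    ContinuousLinearMap.comp_apply, ContinuousLinearMap.adjoint_inner_left,
    ← inner_map_eq_inner_sqrt hs.1] at hc hc'
  exact ⟨c, hc, hc'⟩

theorem IsState.hasSum_inner_mul (hs : IsState s) (A : K →L[ℂ] K) (b : HilbertBasis ι ℂ K) :
    HasSum (fun i => ⟪b i, s (A (b i))⟫_ℂ) (tr (s * A)) := by
  obtain ⟨_, hc, htr⟩ := hs.exists_hasSum_inner A b (onb K)
  obtain ⟨_, hc', hb⟩ := hs.exists_hasSum_inner A b b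
  have htr_eq : tr (s * A) = _ := htr.tsum_eq
  rwa [htr_eq, hc.unique hc']

theorem IsState.hasSum_inner_sqrt (hs : IsState s) (A : K →L[ℂ] K) (b : HilbertBasis ι ℂ K) :
    HasSum (fun i => ⟪CFC.sqrt s (b i), A (CFC.sqrt s (b i))⟫_ℂ) (tr (s * A)) := by
  obtain ⟨_, h, h'⟩ := hs.exists_hasSum_inner A b b
  rwa [(hs.hasSum_inner_mul A b).unique h']

theorem IsState.tr_one (hs : IsState s) : tr (s * 1) = 1 := by
  rw [mul_one]
  exact hs.2.tsum_eq

theorem IsState.tr_add (hs : IsState s) (A B : K →L[ℂ] K) :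
    tr (s * (A + B)) = tr (s * A) + tr (s * B) :=
  (hs.hasSum_inner_mul _ (onb K)).unique <| by
    simpa [inner_add_right] using
      (hs.hasSum_inner_mul A (onb K)).add (hs.hasSum_inner_mul B (onb K))

theorem IsState.tr_smul (hs : IsState s) (c : ℂ) (A : K →L[ℂ] K) :
    tr (s * (c • A)) = c * tr (s * A) :=
  (hs.hasSum_inner_mul _ (onb K)).unique <| by
    simpa [inner_smul_right] using (hs.hasSum_inner_mul A (onb K)).mul_left c

theorem IsState.tr_nonneg (hs : IsState s) {A : K →L[ℂ] K} (hA : 0 ≤ A) : 0 ≤ tr (s * A) :=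
  (hs.hasSum_inner_sqrt A (onb K)).nonneg fun _ => nonneg_iff_forall_inner_nonneg.1 hA _

theorem IsState.norm_tr_le (hs : IsState s) (A : K →L[ℂ] K) : ‖tr (s * A)‖ ≤ ‖A‖ := by
  rw [← (hs.hasSum_inner_sqrt A (onb K)).tsum_eq]
  refine tsum_of_norm_bounded (by simpa using (hs.hasSum_sq_norm_sqrt (onb K)).mul_left ‖A‖)
    fun i => ?_
  calc ‖⟪CFC.sqrt s (onb K i), A (CFC.sqrt s (onb K i))⟫_ℂ‖
      ≤ ‖CFC.sqrt s (onb K i)‖ * (‖A‖ * ‖CFC.sqrt s (onb K i)‖) :=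
        (norm_inner_le_norm _ _).trans (by gcongr; exact A.le_opNorm _)
    _ = ‖A‖ * ‖CFC.sqrt s (onb K i)‖ ^ 2 := by ring

theorem IsState.re_tr_smul_one_sub (hs : IsState s) (c : ℝ) (A : K →L[ℂ] K) :
    (tr (s * ((c : ℂ) • 1 - A))).re = c - (tr (s * A)).re := by
  have h := hs.tr_add ((c : ℂ) • 1 - A) A
  rw [sub_add_cancel, hs.tr_smul, hs.tr_one] at h
  simpa using (congrArg Complex.re (eq_sub_of_add_eq h.symm))

theorem IsState.hasSum_re_inner_sqrt_right (hs : IsState s) {A : K →L[ℂ] K} (hA : 0 ≤ A)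
    (b : HilbertBasis ι ℂ K) :
    HasSum (fun i => (⟪CFC.sqrt A (b i), s (CFC.sqrt A (b i))⟫_ℂ).re) (tr (s * A)).re := by
  have h : HasSum (fun i => ‖(CFC.sqrt A ∘L CFC.sqrt s) (b i)‖ ^ 2) (tr (s * A)).re := by
    convert Complex.hasSum_re (hs.hasSum_inner_sqrt A b) using 2 with i
    rw [inner_map_self_eq_sq_norm_sqrt hA, Complex.ofReal_re, ContinuousLinearMap.comp_apply]
  have hadj : (CFC.sqrt A ∘L CFC.sqrt s)† = CFC.sqrt s ∘L CFC.sqrt A := by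
    rw [ContinuousLinearMap.adjoint_comp, adjoint_eq_self_of_nonneg (CFC.sqrt_nonneg s),
      adjoint_eq_self_of_nonneg (CFC.sqrt_nonneg A)]
  convert hasSum_sq_norm_adjoint b b h using 2 with i
  rw [inner_map_self_eq_sq_norm_sqrt hs.1, Complex.ofReal_re, hadj, ContinuousLinearMap.comp_apply]

theorem convex_isState : Convex ℝ {s : K →L[ℂ] K | IsState s} := by
  intro s hs t ht a b ha hb hab
  refine ⟨add_nonneg (smul_nonneg ha hs.1) (smul_nonneg hb ht.1), ?_⟩
  have h := (hs.2.mul_left (a : ℂ)).add (ht.2.mul_left (b : ℂ))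
  rw [mul_one, mul_one, ← Complex.ofReal_add, hab, Complex.ofReal_one] at h
  simpa [inner_add_right] using h

theorem tr_convex_comb_mul (hs : IsState s) (ht : IsState t) {a b : ℝ}
    (ha : 0 ≤ a) (hb : 0 ≤ b) (hab : a + b = 1) (A : K →L[ℂ] K) :
    tr ((a • s + b • t) * A) = a * tr (s * A) + b * tr (t * A) := by
  refine ((convex_isState hs ht ha hb hab).hasSum_inner_mul A (onb K)).unique ?_
  simpa [inner_add_right] using ((hs.hasSum_inner_mul A (onb K)).mul_left (a : ℂ)).add
    ((ht.hasSum_inner_mul A (onb K)).mul_left (b : ℂ))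

theorem isState_rankOne {u : K} (hu : ‖u‖ = 1) : IsState (InnerProductSpace.rankOne ℂ u u) := by
  refine ⟨(ContinuousLinearMap.nonneg_iff_isPositive _).2
    (InnerProductSpace.isPositive_rankOne_self u), ?_⟩
  simpa [inner_smul_right, inner_self_eq_norm_sq_to_K, hu] using
    (onb K).hasSum_inner_mul_inner u u

theorem tr_rankOne_mul {u : K} (hu : ‖u‖ = 1) (A : K →L[ℂ] K) :
    tr (InnerProductSpace.rankOne ℂ u u * A) = ⟪u, A u⟫_ℂ := by
  refine ((isState_rankOne hu).hasSum_inner_mul A (onb K)).unique ?_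
  simpa [inner_smul_right, ContinuousLinearMap.adjoint_inner_left] using
    (onb K).hasSum_inner_mul_inner ((A†) u) u

theorem exists_isState_inner_map_self {u : K} (hu : u ≠ 0) :
    ∃ s : K →L[ℂ] K, IsState s ∧ ∀ A : K →L[ℂ] K, ⟪u, A u⟫_ℂ = (‖u‖ : ℂ) ^ 2 * tr (s * A) := by
  have hw : ‖((‖u‖⁻¹ : ℝ) : ℂ) • u‖ = 1 := by simp [norm_smul, hu]
  refine ⟨_, isState_rankOne hw, fun A => ?_⟩
  rw [tr_rankOne_mul hw, map_smul, inner_smul_left, inner_smul_right, Complex.conj_ofReal,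
    Complex.ofReal_inv]
  have : (‖u‖ : ℂ) ≠ 0 := by simpa using hu
  field_simp

section Continuity

open Filter Topology

variable {α : Type*} {l : Filter α} {S : α → K →L[ℂ] K}

theorem eventually_lt_re_tr (hS : ∀ a, IsState (S a)) (hs : IsState s)
    (h : ∀ v, Tendsto (fun a => ⟪v, S a v⟫_ℂ) l (𝓝 ⟪v, s v⟫_ℂ)) {A : K →L[ℂ] K} (hA : 0 ≤ A)
    {c : ℝ} (hc : c < (tr (s * A)).re) : ∀ᶠ a in l, c < (tr (S a * A)).re := by
  obtain ⟨F, hF⟩ := ((tendsto_order.1 (hs.hasSum_re_inner_sqrt_right hA (onb K))).1 c hc).exists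
  have hlim : Tendsto (fun a => ∑ i ∈ F, (⟪CFC.sqrt A (onb K i), S a (CFC.sqrt A (onb K i))⟫_ℂ).re)
      l (𝓝 (∑ i ∈ F, (⟪CFC.sqrt A (onb K i), s (CFC.sqrt A (onb K i))⟫_ℂ).re)) :=
    tendsto_finsetSum F fun i _ => (Complex.continuous_re.tendsto _).comp (h _)
  filter_upwards [(tendsto_order.1 hlim).1 c hF] with a ha
  refine ha.trans_le (sum_le_hasSum F (fun i _ => ?_)
    ((hS a).hasSum_re_inner_sqrt_right hA (onb K)))
  exact (Complex.nonneg_iff.1 (nonneg_iff_forall_inner_nonneg.1 (hS a).1 _)).1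

/-- For positive `A`, `tr (s A)` is a sum of nonnegative terms continuous in `s`, hence lower
semicontinuous; since `tr (s (‖A‖ - A)) = ‖A‖ - tr (s A)`, it is upper semicontinuous as well. -/
theorem tendsto_tr_of_nonneg (hS : ∀ a, IsState (S a)) (hs : IsState s)
    (h : ∀ v, Tendsto (fun a => ⟪v, S a v⟫_ℂ) l (𝓝 ⟪v, s v⟫_ℂ)) {A : K →L[ℂ] K} (hA : 0 ≤ A) :
    Tendsto (fun a => tr (S a * A)) l (𝓝 (tr (s * A))) := by
  have hre : Tendsto (fun a => (tr (S a * A)).re) l (𝓝 (tr (s * A)).re) := by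
    refine tendsto_order.2 ⟨fun c hc => eventually_lt_re_tr hS hs h hA hc, fun c hc => ?_⟩
    have hA' : 0 ≤ (‖A‖ : ℂ) • 1 - A := by
      rw [sub_nonneg]
      simpa [Algebra.algebraMap_eq_smul_one] using
        (IsSelfAdjoint.of_nonneg hA).le_algebraMap_norm_self
    have hlt : ‖A‖ - c < (tr (s * ((‖A‖ : ℂ) • 1 - A))).re := by
      rw [hs.re_tr_smul_one_sub]
      linarith
    filter_upwards [eventually_lt_re_tr hS hs h hA' hlt] with a ha
    rw [(hS a).re_tr_smul_one_sub] at ha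
    linarith
  have hofReal {r : K →L[ℂ] K} (hr : IsState r) : tr (r * A) = ((tr (r * A)).re : ℂ) :=
    Complex.ext rfl (Complex.nonneg_iff.1 (hr.tr_nonneg hA)).2.symm
  rw [hofReal hs]
  exact ((Complex.continuous_ofReal.tendsto _).comp hre).congr fun a => (hofReal (hS a)).symm

theorem tendsto_tr (hS : ∀ a, IsState (S a)) (hs : IsState s)
    (h : ∀ v, Tendsto (fun a => ⟪v, S a v⟫_ℂ) l (𝓝 ⟪v, s v⟫_ℂ)) (A : K →L[ℂ] K) :
    Tendsto (fun a => tr (S a * A)) l (𝓝 (tr (s * A))) := by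
  have hA : A ∈ Submodule.span ℂ {B : K →L[ℂ] K | 0 ≤ B} := by simp [CStarAlgebra.span_nonneg]
  induction hA using Submodule.span_induction with
  | mem A hA => exact tendsto_tr_of_nonneg hS hs h hA
  | zero => simpa only [mul_zero] using tendsto_const_nhds
  | add A B _ _ hA hB => simpa only [hs.tr_add, (hS _).tr_add] using hA.add hB
  | smul c A _ hA => simpa only [hs.tr_smul, (hS _).tr_smul] using hA.const_mul c

end Continuity

end States

/-! ### Tensor products of Hilbert spaces, operators and states -/

section Tensor

variable {H₁ : Type*} [NormedAddCommGroup H₁] [InnerProductSpace ℂ H₁]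
variable {H₂ : Type*} [NormedAddCommGroup H₂] [InnerProductSpace ℂ H₂]

/-- The elementary tensor `x ⊗ y` in the Hilbert space tensor product. -/
def htmul (x : H₁) (y : H₂) : HTensor H₁ H₂ := ((x ⊗ₜ[ℂ] y : H₁ ⊗[ℂ] H₂) : HTensor H₁ H₂)

theorem inner_htmul (x x' : H₁) (y y' : H₂) :
    ⟪htmul x y, htmul x' y'⟫_ℂ = ⟪x, x'⟫_ℂ * ⟪y, y'⟫_ℂ := by
  rw [htmul, htmul, UniformSpace.Completion.inner_coe, TensorProduct.inner_tmul]

theorem continuous_htmul : Continuous fun q : H₁ × H₂ => htmul q.1 q.2 :=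
  (UniformSpace.Completion.continuous_coe _).comp TensorProduct.continuous_tmul

theorem dense_span_image2_htmul {s : Set H₁} {t : Set H₂}
    (hs : Dense (Submodule.span ℂ s : Set H₁)) (ht : Dense (Submodule.span ℂ t : Set H₂)) :
    Dense (Submodule.span ℂ (Set.image2 htmul s t) : Set (HTensor H₁ H₂)) := by
  set V := Submodule.span ℂ (Set.image2 htmul s t)
  have htmul_mem (x : H₁) (y : H₂) : htmul x y ∈ V.topologicalClosure := by
    refine map_mem_closure₂ continuous_htmul (hs x) (ht y) fun x hx y hy => ?_
    let f : H₁ →ₗ[ℂ] H₂ →ₗ[ℂ] HTensor H₁ H₂ :=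
      (TensorProduct.mk ℂ H₁ H₂).compr₂ UniformSpace.Completion.toComplL.toLinearMap
    exact (Submodule.map₂_span_span ℂ f s t).le (Submodule.apply_mem_map₂ f hx hy)
  refine dense_closure.1 (UniformSpace.Completion.denseRange_coe.mono ?_)
  rintro _ ⟨z, rfl⟩
  induction z using TensorProduct.induction_on with
  | zero => exact V.topologicalClosure.zero_mem
  | tmul x y => exact htmul_mem x y
  | add z z' hz hz' =>
    rw [UniformSpace.Completion.coe_add]
    exact V.topologicalClosure.add_mem hz hz'

theorem dense_span_range_htmul :
    Dense (Submodule.span ℂ (Set.range (htmul (H₁ := H₁) (H₂ := H₂)).uncurry) :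
      Set (HTensor H₁ H₂)) := by
  rw [← Set.image_univ, ← Set.univ_prod_univ, Set.image_uncurry_prod]
  exact dense_span_image2_htmul (by simp) (by simp)

theorem ext_htmul {E : Type*} [NormedAddCommGroup E] [NormedSpace ℂ E]
    {A B : HTensor H₁ H₂ →L[ℂ] E} (h : ∀ x y, A (htmul x y) = B (htmul x y)) : A = B :=
  ContinuousLinearMap.ext_on dense_span_range_htmul (by rintro _ ⟨q, rfl⟩; exact h _ _)

instance [TopologicalSpace.SeparableSpace H₁] [TopologicalSpace.SeparableSpace H₂] :
    TopologicalSpace.SeparableSpace (HTensor H₁ H₂) := by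
  have h : TopologicalSpace.IsSeparable (Set.range (htmul (H₁ := H₁) (H₂ := H₂)).uncurry) :=
    TopologicalSpace.isSeparable_range continuous_htmul
  rw [← TopologicalSpace.isSeparable_univ_iff, ← dense_span_range_htmul.closure_eq]
  exact h.span.closure

theorem opTensor_htmul (A : H₁ →L[ℂ] H₁) (B : H₂ →L[ℂ] H₂) (x : H₁) (y : H₂) :
    opTensor A B (htmul x y) = htmul (A x) (B y) := by
  rw [htmul, opTensor, ContinuousLinearMap.completion_apply_coe, TensorProduct.mapL_tmul, htmul]

theorem opTensor_mul (A A' : H₁ →L[ℂ] H₁) (B B' : H₂ →L[ℂ] H₂) :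
    opTensor A B * opTensor A' B' = opTensor (A * A') (B * B') :=
  ext_htmul fun x y => by simp only [mul_apply_eq_comp, opTensor_htmul]

theorem norm_opTensor_le (A : H₁ →L[ℂ] H₁) (B : H₂ →L[ℂ] H₂) : ‖opTensor A B‖ ≤ ‖A‖ * ‖B‖ := by
  refine ContinuousLinearMap.opNorm_le_bound _ (by positivity) fun z => ?_
  induction z using UniformSpace.Completion.induction_on with
  | hp => exact isClosed_le (by fun_prop) (by fun_prop)
  | ih z =>
    rw [opTensor, ContinuousLinearMap.completion_apply_coe, UniformSpace.Completion.norm_coe,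
      UniformSpace.Completion.norm_coe]
    exact (TensorProduct.mapL A B).le_of_opNorm_le (TensorProduct.norm_mapL_le A B) z

/-- The Hilbert basis of the tensor product formed by the products of two Hilbert bases. -/
def tensorBasis {ι κ : Type*} (b : HilbertBasis ι ℂ H₁) (c : HilbertBasis κ ℂ H₂) :
    HilbertBasis (ι × κ) ℂ (HTensor H₁ H₂) :=
  HilbertBasis.mk (v := fun q : ι × κ => htmul (b q.1) (c q.2))
    (by
      classical
      rw [orthonormal_iff_ite]
      intro q q'
      rw [inner_htmul, orthonormal_iff_ite.1 b.orthonormal, orthonormal_iff_ite.1 c.orthonormal]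
      rw [ite_zero_mul_ite_zero, mul_one]
      simp only [Prod.ext_iff])
    (by
      rw [← Set.image2_range]
      exact (Submodule.dense_iff_topologicalClosure_eq_top.1 (dense_span_image2_htmul
        (Submodule.dense_iff_topologicalClosure_eq_top.2 b.dense_span)
        (Submodule.dense_iff_topologicalClosure_eq_top.2 c.dense_span))).ge)

theorem tensorBasis_apply {ι κ : Type*} (b : HilbertBasis ι ℂ H₁) (c : HilbertBasis κ ℂ H₂)
    (q : ι × κ) : tensorBasis b c q = htmul (b q.1) (c q.2) := by
  rw [tensorBasis, HilbertBasis.coe_mk]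

variable [CompleteSpace H₁] [CompleteSpace H₂]

theorem adjoint_opTensor (A : H₁ →L[ℂ] H₁) (B : H₂ →L[ℂ] H₂) :
    (opTensor A B)† = opTensor (A†) (B†) := by
  refine ext_htmul fun x y => ext_inner_right ℂ fun z => ?_
  have h : innerSL ℂ (((opTensor A B)†) (htmul x y)) = innerSL ℂ (opTensor (A†) (B†) (htmul x y)) :=
    ext_htmul fun x' y' => by
      simp only [innerSL_apply_apply, ContinuousLinearMap.adjoint_inner_left, opTensor_htmul,
        inner_htmul]
  exact DFunLike.congr_fun h z

theorem opTensor_nonneg {A : H₁ →L[ℂ] H₁} {B : H₂ →L[ℂ] H₂} (hA : 0 ≤ A) (hB : 0 ≤ B) :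
    0 ≤ opTensor A B := by
  have h := adjoint_mul_self_nonneg (opTensor (CFC.sqrt A) (CFC.sqrt B))
  rwa [adjoint_opTensor, adjoint_eq_self_of_nonneg (CFC.sqrt_nonneg A),
    adjoint_eq_self_of_nonneg (CFC.sqrt_nonneg B), opTensor_mul, CFC.sqrt_mul_sqrt_self A hA,
    CFC.sqrt_mul_sqrt_self B hB] at h

theorem hasSum_mul_of_hasSum {ι κ : Type*} {f : ι → ℂ} {g : κ → ℂ} {a c : ℂ} (hf : HasSum f a)
    (hg : HasSum g c) : HasSum (fun q : ι × κ => f q.1 * g q.2) (a * c) :=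
  hf.mul hg (summable_mul_of_summable_norm hf.summable.norm hg.summable.norm)

variable {s : H₁ →L[ℂ] H₁} {t : H₂ →L[ℂ] H₂}

theorem IsState.opTensor (hs : IsState s) (ht : IsState t) : IsState (opTensor s t) := by
  refine isState_of_hasSum_inner (opTensor_nonneg hs.1 ht.1) (tensorBasis (onb H₁) (onb H₂)) ?_
  simpa only [tensorBasis_apply, opTensor_htmul, inner_htmul, mul_one] using
    hasSum_mul_of_hasSum hs.2 ht.2

theorem tr_opTensor_mul (hs : IsState s) (ht : IsState t) (A : H₁ →L[ℂ] H₁) (B : H₂ →L[ℂ] H₂) :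
    tr (opTensor s t * opTensor A B) = tr (s * A) * tr (t * B) := by
  have h := (hs.opTensor ht).hasSum_inner_mul (QRV.opTensor A B) (tensorBasis (onb H₁) (onb H₂))
  have h' := hasSum_mul_of_hasSum (hs.hasSum_inner_mul A (onb H₁)) (ht.hasSum_inner_mul B (onb H₂))
  simp only [tensorBasis_apply, opTensor_htmul, inner_htmul] at h
  exact HasSum.unique h h'

end Tensor

/-! ### Weak measurability -/

section WeakMeasurability

variable {X : Type*} [MeasurableSpace X]
variable {K : Type*} [NormedAddCommGroup K] [InnerProductSpace ℂ K]

/-- Weak measurability of an operator-valued function: all its matrix entries are measurable. On a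
separable Hilbert space this is equivalent to being a quantum random variable, and it has the
better closure properties. -/
def WeakMeasurable (f : X → (K →L[ℂ] K)) : Prop :=
  ∀ u v : K, Measurable fun x => ⟪u, f x v⟫_ℂ

theorem measurable_of_hasSum {ι : Type*} [Countable ι] {f : ι → X → ℂ} {g : X → ℂ}
    (hf : ∀ i, Measurable (f i)) (h : ∀ x, HasSum (fun i => f i x) (g x)) : Measurable g := by
  rw [← funext fun x => (h x).tsum_eq]
  exact Measurable.tsum hf

namespace WeakMeasurable

variable {f g : X → (K →L[ℂ] K)}

theorem const (A : K →L[ℂ] K) : WeakMeasurable fun _ : X => A :=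
  fun _ _ => measurable_const

theorem add (hf : WeakMeasurable f) (hg : WeakMeasurable g) : WeakMeasurable (f + g) :=
  fun u v => by
    simp only [Pi.add_apply, add_apply, inner_add_right]
    exact (hf u v).add (hg u v)

theorem smul (hf : WeakMeasurable f) (c : ℂ) : WeakMeasurable (c • f) :=
  fun u v => by
    simpa only [Pi.smul_apply, smul_apply, inner_smul_right] using (hf u v).const_mul c

theorem indicator (hf : WeakMeasurable f) {E : Set X} (hE : MeasurableSet E) :
    WeakMeasurable (E.indicator f) := fun u v => by
  convert (hf u v).indicator hE using 1
  ext x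
  by_cases hx : x ∈ E <;> simp [hx]

theorem of_tendsto {F : ℕ → X → (K →L[ℂ] K)} (hF : ∀ n, WeakMeasurable (F n))
    (h : ∀ x, Filter.Tendsto (fun n => F n x) Filter.atTop (nhds (f x))) : WeakMeasurable f :=
  fun u v => measurable_of_tendsto_metrizable (fun n => hF n u v) <| tendsto_pi_nhds.2 fun x =>
    tendsto_const_nhds.inner (((ContinuousLinearMap.apply ℂ K v).continuous.tendsto _).comp (h x))

theorem measurableSet_nonneg [TopologicalSpace.SeparableSpace K] (hf : WeakMeasurable f) :
    MeasurableSet {x | 0 ≤ f x} := by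
  obtain ⟨Q, hQc, hQd⟩ := TopologicalSpace.exists_countable_dense K
  have hset : {x | 0 ≤ f x} = ⋂ u ∈ Q, {x | 0 ≤ ⟪u, f x u⟫_ℂ} := by
    ext x
    simp only [Set.mem_ofPred_eq, Set.mem_iInter]
    exact ⟨fun h u _ => nonneg_iff_forall_inner_nonneg.1 h u, nonneg_of_dense hQd⟩
  rw [hset]
  exact .biInter hQc fun u _ => hf u u measurableSet_Ici

variable [CompleteSpace K]

theorem of_inner_self (hf : ∀ u, Measurable fun x => ⟪u, f x u⟫_ℂ) : WeakMeasurable f := by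
  intro u v
  simp only [inner_apply_polarization _ u v]
  have := hf (u + v)
  have := hf (u - v)
  have := hf (u + Complex.I • v)
  have := hf (u - Complex.I • v)
  fun_prop

theorem of_isQRV (hf : IsQRV f) : WeakMeasurable f := by
  refine of_inner_self fun u => ?_
  by_cases hu : u = 0
  · simp [hu]
  · obtain ⟨s, hs, h⟩ := exists_isState_inner_map_self hu
    simpa only [h] using (hf s hs).const_mul _

theorem of_mem_qrvSpan (hf : f ∈ qrvSpan X K) : WeakMeasurable f := by
  induction hf using Submodule.span_induction with
  | mem f hf => exact of_isQRV hf.1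
  | zero => exact const 0
  | add f g _ _ hf hg => exact hf.add hg
  | smul c f _ hf => exact hf.smul c

theorem of_hilbertBasis {ι : Type*} [Countable ι] (b : HilbertBasis ι ℂ K)
    (hf : ∀ i j, Measurable fun x => ⟪b i, f x (b j)⟫_ℂ) : WeakMeasurable f := by
  have hrow (i : ι) (v : K) : Measurable fun x => ⟪b i, f x v⟫_ℂ := by
    refine measurable_of_hasSum (fun j => (hf i j).mul_const ⟪b j, v⟫_ℂ) fun x => ?_
    simpa only [ContinuousLinearMap.adjoint_inner_left] using
      b.hasSum_inner_mul_inner (((f x)†) (b i)) v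
  exact fun u v => measurable_of_hasSum (fun i => (hrow i v).const_mul ⟪u, b i⟫_ℂ) fun x =>
    b.hasSum_inner_mul_inner u (f x v)

variable [TopologicalSpace.SeparableSpace K]

theorem isQRV (hf : WeakMeasurable f) : IsQRV f := fun s hs =>
  measurable_of_hasSum (fun i => hf (s (onb K i)) (onb K i)) fun x => by
    simpa only [inner_map_of_nonneg hs.1] using hs.hasSum_inner_mul (f x) (onb K)

theorem mem_qrvSpan (hf : WeakMeasurable f) (h : ∀ x, 0 ≤ f x) : f ∈ qrvSpan X K :=
  Submodule.subset_span ⟨hf.isQRV, h⟩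

theorem mul (hf : WeakMeasurable f) (hg : WeakMeasurable g) :
    WeakMeasurable fun x => f x * g x := fun u v =>
  measurable_of_hasSum (fun i => (hf u (onb K i)).mul (hg (onb K i) v)) fun x => by
    simpa only [ContinuousLinearMap.adjoint_inner_left, Pi.mul_apply, mul_apply_eq_comp] using
      (onb K).hasSum_inner_mul_inner (((f x)†) u) (g x v)

theorem aeval (hf : WeakMeasurable f) (p : Polynomial ℝ) :
    WeakMeasurable fun x => Polynomial.aeval (f x) p := by
  induction p using Polynomial.induction_on with
  | C a => simpa using const _
  | add p q hp hq =>
    simp only [map_add]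
    exact hp.add hq
  | monomial n a h => simpa [pow_succ, mul_assoc] using h.mul hf

theorem cfc (hf : WeakMeasurable f) (hsa : ∀ x, IsSelfAdjoint (f x)) {φ : ℝ → ℝ}
    (hφ : Continuous φ) : WeakMeasurable fun x => cfc φ (f x) := by
  have hpoly (n : ℕ) : ∃ p : Polynomial ℝ,
      ∀ t ∈ Set.Icc (-n : ℝ) n, |p.eval t - φ t| < 1 / ((n : ℝ) + 1) :=
    exists_polynomial_near_of_continuousOn _ _ φ hφ.continuousOn _ (by positivity)
  choose p hp using hpoly
  refine of_tendsto (fun n => hf.aeval (p n)) fun x => ?_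
  simp only [← fun n => cfc_polynomial (p n) (f x) (hsa x)]
  refine tendsto_cfc_fun (Metric.tendstoUniformlyOn_iff.2 fun ε hε => ?_)
    (.of_forall fun n => (p n).continuous.continuousOn)
  filter_upwards [Filter.eventually_ge_atTop ⌈‖f x‖⌉₊,
    tendsto_one_div_add_atTop_nhds_zero_nat.eventually_lt_const hε] with n hn hnε t ht
  rw [dist_comm, Real.dist_eq]
  refine (hp n t (abs_le.1 ?_)).trans hnε
  calc |t| ≤ ‖f x‖ * ‖(1 : K →L[ℂ] K)‖ := spectrum.norm_le_norm_mul_of_mem ht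
    _ ≤ ‖f x‖ := mul_le_of_le_one_right (norm_nonneg _) ContinuousLinearMap.norm_id_le
    _ ≤ n := Nat.ceil_le.1 hn

theorem sqrt (hf : WeakMeasurable f) : WeakMeasurable fun x => CFC.sqrt (f x) := by
  set g := Set.indicator {x | 0 ≤ f x} f with hg_def
  have hg (x : X) : 0 ≤ g x := Set.indicator_nonneg (fun _ hx => hx) x
  have hsqrt : (fun x => CFC.sqrt (f x)) = fun x => _root_.cfc Real.sqrt (g x) := by
    ext1 x
    rw [← cfcₙ_eq_cfc, ← CFC.sqrt_eq_real_sqrt (g x) (hg x)]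
    by_cases hx : 0 ≤ f x
    · rw [hg_def, Set.indicator_of_mem (s := {x | 0 ≤ f x}) hx]
    · rw [hg_def, Set.indicator_of_notMem (s := {x | 0 ≤ f x}) hx, CFC.sqrt_zero,
        CFC.sqrt_of_not_nonneg hx]
  rw [hsqrt]
  exact (hf.indicator hf.measurableSet_nonneg).cfc (fun x => .of_nonneg (hg x))
    Real.continuous_sqrt

end WeakMeasurable

theorem WeakMeasurable.funTensor {H₁ H₂ : Type*} [NormedAddCommGroup H₁] [InnerProductSpace ℂ H₁]
    [CompleteSpace H₁] [TopologicalSpace.SeparableSpace H₁] [NormedAddCommGroup H₂]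
    [InnerProductSpace ℂ H₂] [CompleteSpace H₂] [TopologicalSpace.SeparableSpace H₂]
    {f : X → (H₁ →L[ℂ] H₁)} {g : X → (H₂ →L[ℂ] H₂)} (hf : WeakMeasurable f)
    (hg : WeakMeasurable g) : WeakMeasurable (funTensor f g) := by
  refine .of_hilbertBasis (tensorBasis (onb H₁) (onb H₂)) fun i j => ?_
  simp only [tensorBasis_apply, QRV.funTensor, opTensor_htmul, inner_htmul]
  exact (hf _ _).mul (hg _ _)

end WeakMeasurability

/-! ### Operator-valued densities -/

section Densities

variable {X : Type*} [MeasurableSpace X] {μ : Measure X}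

/-- `F` is a density of the complex set function `m` with respect to `μ`. For a POVM `ν` this is
applied to the matrix entries `m E = ⟪u, ν E v⟫`. -/
def HasDensity (μ : Measure X) (m : Set X → ℂ) (F : X → ℂ) : Prop :=
  Integrable F μ ∧ ∀ E, MeasurableSet E → m E = ∫ x in E, F x ∂μ

namespace HasDensity

variable {m m' : Set X → ℂ} {F G : X → ℂ}

theorem add (hF : HasDensity μ m F) (hG : HasDensity μ m' G) :
    HasDensity μ (fun E => m E + m' E) fun x => F x + G x :=
  ⟨hF.1.add hG.1, fun E hE => by
    simp only [hF.2 E hE, hG.2 E hE, integral_add hF.1.integrableOn hG.1.integrableOn]⟩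

theorem const_mul (hF : HasDensity μ m F) (c : ℂ) :
    HasDensity μ (fun E => c * m E) fun x => c * F x :=
  ⟨hF.1.const_mul c, fun E hE => by simp only [hF.2 E hE, integral_const_mul]⟩

theorem sub (hF : HasDensity μ m F) (hG : HasDensity μ m' G) :
    HasDensity μ (fun E => m E - m' E) fun x => F x - G x := by
  simpa only [neg_one_mul, ← sub_eq_add_neg] using hF.add (hG.const_mul (-1))

theorem ae_eq (hF : HasDensity μ m F) (hG : HasDensity μ m G) : F =ᵐ[μ] G :=
  Integrable.ae_eq_of_forall_setIntegral_eq _ _ hF.1 hG.1 fun E hE _ => by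
    rw [← hF.2 E hE, ← hG.2 E hE]

theorem ae_nonneg (hF : HasDensity μ m F) (hm : ∀ E, MeasurableSet E → 0 ≤ m E) :
    ∀ᵐ x ∂μ, 0 ≤ F x := by
  have hm' (E : Set X) (hE : MeasurableSet E) : 0 ≤ ∫ x in E, F x ∂μ := hF.2 E hE ▸ hm E hE
  have hre : 0 ≤ᵐ[μ] fun x => (F x).re :=
    ae_nonneg_of_forall_setIntegral_nonneg hF.1.re fun E hE _ =>
      (Complex.nonneg_iff.1 (hm' E hE)).1.trans_eq (integral_re hF.1.integrableOn).symm
  have him : (fun x => (F x).im) =ᵐ[μ] 0 :=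
    Integrable.ae_eq_zero_of_forall_setIntegral_eq_zero hF.1.im fun E hE _ =>
      (integral_im hF.1.integrableOn).trans (Complex.nonneg_iff.1 (hm' E hE)).2.symm
  filter_upwards [hre, him] with x hx hx'
  exact Complex.nonneg_iff.2 ⟨hx, hx'.symm⟩

end HasDensity

variable {K : Type*} [NormedAddCommGroup K] [InnerProductSpace ℂ K] [CompleteSpace K]
variable {ν : POVM X K} {D D' : X → (K →L[ℂ] K)}

theorem isRNDeriv_rnDeriv (h : HasRNDeriv ν μ) : IsRNDeriv ν μ (rnDeriv ν μ) := by
  rw [rnDeriv, dif_pos h]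
  exact h.choose_spec

theorem weakMeasurable_rnDeriv (h : HasRNDeriv ν μ) : WeakMeasurable (rnDeriv ν μ) :=
  .of_isQRV (isRNDeriv_rnDeriv h).1

theorem IsRNDeriv.hasDensity (hD : IsRNDeriv ν μ D) {u v : K}
    (hu : u ∈ Submodule.span ℂ (Set.range (onb K)))
    (hv : v ∈ Submodule.span ℂ (Set.range (onb K))) :
    HasDensity μ (fun E => ⟪u, ν.toFun E v⟫_ℂ) fun x => ⟪u, D x v⟫_ℂ := by
  induction hu, hv using Submodule.span_induction₂ with
  | mem_mem u v hu hv =>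
    obtain ⟨⟨i, rfl⟩, ⟨j, rfl⟩⟩ := And.intro hu hv
    exact hD.2 i j
  | zero_left v _ => simp [HasDensity]
  | zero_right u _ => simp [HasDensity]
  | add_left u u' v _ _ _ hu hu' => simpa only [inner_add_left] using hu.add hu'
  | add_right u v v' _ _ _ hv hv' => simpa only [map_add, inner_add_right] using hv.add hv'
  | smul_left c u v _ _ h => simpa only [inner_smul_left] using h.const_mul _
  | smul_right c u v _ _ h => simpa only [map_smul, inner_smul_right] using h.const_mul c

variable [TopologicalSpace.SeparableSpace K]

theorem IsRNDeriv.ae_nonneg (hD : IsRNDeriv ν μ D) : ∀ᵐ x ∂μ, 0 ≤ D x := by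
  have hdense : Dense (Submodule.span ℂ (Set.range (onb K)) : Set K) :=
    Submodule.dense_iff_topologicalClosure_eq_top.2 (onb K).dense_span
  obtain ⟨Q, hQspan, hQc, hQd⟩ := hdense.exists_countable_dense_subset
  have hentry : ∀ᵐ x ∂μ, ∀ u ∈ Q, 0 ≤ ⟪u, D x u⟫_ℂ :=
    (ae_ball_iff hQc).2 fun u hu => (hD.hasDensity (hQspan hu) (hQspan hu)).ae_nonneg
      fun E hE => nonneg_iff_forall_inner_nonneg.1 (ν.nonneg E hE) u
  filter_upwards [hentry] with x hx using nonneg_of_dense hQd hx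

theorem IsRNDeriv.ae_eq (hD : IsRNDeriv ν μ D) (hD' : IsRNDeriv ν μ D') : D =ᵐ[μ] D' := by
  have hentry : ∀ᵐ x ∂μ, ∀ i j,
      ⟪onb K i, D x (onb K j)⟫_ℂ = ⟪onb K i, D' x (onb K j)⟫_ℂ :=
    ae_all_iff.2 fun i => ae_all_iff.2 fun j => HasDensity.ae_eq (hD.2 i j) (hD'.2 i j)
  filter_upwards [hentry] with x hx
  refine ContinuousLinearMap.ext_on
    (Submodule.dense_iff_topologicalClosure_eq_top.2 (onb K).dense_span) ?_
  rintro _ ⟨j, rfl⟩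
  refine (onb K).repr.injective (lp.ext (funext fun i => ?_))
  simpa only [HilbertBasis.repr_apply_apply] using hx i j

variable {H₁ : Type*} [NormedAddCommGroup H₁] [InnerProductSpace ℂ H₁] [CompleteSpace H₁]
variable {H₂ : Type*} [NormedAddCommGroup H₂] [InnerProductSpace ℂ H₂] [CompleteSpace H₂]
variable {ν₁ : POVM X H₁} {ν₂ : POVM X H₂} {ν₁₂ : POVM X (HTensor H₁ H₂)}

theorem IsTensorPOVM.hasDensity (h : IsTensorPOVM μ ν₁ ν₂ ν₁₂) (u v : HTensor H₁ H₂) :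
    HasDensity μ (fun E => ⟪u, ν₁₂.toFun E v⟫_ℂ)
      fun x => ⟪u, funTensor (rnDeriv ν₁ μ) (rnDeriv ν₂ μ) x v⟫_ℂ := by
  have hself (u : HTensor H₁ H₂) : HasDensity μ (fun E => ⟪u, ν₁₂.toFun E u⟫_ℂ)
      fun x => ⟪u, funTensor (rnDeriv ν₁ μ) (rnDeriv ν₂ μ) x u⟫_ℂ := by
    by_cases hu : u = 0
    · simp [HasDensity, hu]
    · obtain ⟨s, hs, hsu⟩ := exists_isState_inner_map_self hu
      simp only [hsu]
      exact HasDensity.const_mul (h s hs) _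
  simp only [inner_apply_polarization _ u v, div_eq_inv_mul]
  exact ((((hself _).sub (hself _)).sub ((hself _).const_mul _)).add
    ((hself _).const_mul _)).const_mul _

variable [TopologicalSpace.SeparableSpace H₁] [TopologicalSpace.SeparableSpace H₂]

theorem IsTensorPOVM.isRNDeriv (h : IsTensorPOVM μ ν₁ ν₂ ν₁₂) (h₁ : HasRNDeriv ν₁ μ)
    (h₂ : HasRNDeriv ν₂ μ) : IsRNDeriv ν₁₂ μ (funTensor (rnDeriv ν₁ μ) (rnDeriv ν₂ μ)) :=
  ⟨((weakMeasurable_rnDeriv h₁).funTensor (weakMeasurable_rnDeriv h₂)).isQRV,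
    fun _ _ => h.hasDensity _ _⟩

theorem IsTensorPOVM.hasRNDeriv (h : IsTensorPOVM μ ν₁ ν₂ ν₁₂) (h₁ : HasRNDeriv ν₁ μ)
    (h₂ : HasRNDeriv ν₂ μ) : HasRNDeriv ν₁₂ μ :=
  ⟨_, h.isRNDeriv h₁ h₂⟩

theorem IsTensorPOVM.rnDeriv_ae_eq (h : IsTensorPOVM μ ν₁ ν₂ ν₁₂) (h₁ : HasRNDeriv ν₁ μ)
    (h₂ : HasRNDeriv ν₂ μ) : rnDeriv ν₁₂ μ =ᵐ[μ] funTensor (rnDeriv ν₁ μ) (rnDeriv ν₂ μ) :=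
  (isRNDeriv_rnDeriv (h.hasRNDeriv h₁ h₂)).ae_eq (h.isRNDeriv h₁ h₂)

end Densities

/-! ### The functions `F_s` and the norm `‖·‖_p` -/

section StateFun

variable {X : Type*} [MeasurableSpace X] {μ : Measure X}
variable {K : Type*} [NormedAddCommGroup K] [InnerProductSpace ℂ K] [CompleteSpace K]
variable {ν : POVM X K} {s : K →L[ℂ] K} {f : X → (K →L[ℂ] K)} {x : X}

theorem stateFun_eq_of_mul_self_eq {R : K →L[ℂ] K} (hR : 0 ≤ R) (h : R * R = rnDeriv ν μ x) :
    stateFun ν μ s f x = tr (s * (R * f x * R)) := by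
  rw [stateFun, ← h, CFC.sqrt_mul_self R hR]

theorem stateFun_nonneg (hs : IsState s) (hf : 0 ≤ f x) : 0 ≤ stateFun ν μ s f x :=
  hs.tr_nonneg (conjugate_nonneg_of_nonneg hf (CFC.sqrt_nonneg _))

theorem stateFun_add (hs : IsState s) (f g : X → (K →L[ℂ] K)) (x : X) :
    stateFun ν μ s (f + g) x = stateFun ν μ s f x + stateFun ν μ s g x := by
  simp only [stateFun, Pi.add_apply, mul_add, add_mul, ← hs.tr_add]

theorem stateFun_smul (hs : IsState s) (c : ℂ) (f : X → (K →L[ℂ] K)) (x : X) :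
    stateFun ν μ s (c • f) x = c * stateFun ν μ s f x := by
  simp only [stateFun, Pi.smul_apply, ← hs.tr_smul, mul_smul_comm, smul_mul_assoc]

theorem stateFun_sub (hs : IsState s) (f g : X → (K →L[ℂ] K)) (x : X) :
    stateFun ν μ s (f - g) x = stateFun ν μ s f x - stateFun ν μ s g x := by
  rw [sub_eq_add_neg, ← neg_one_smul ℂ g, stateFun_add hs, stateFun_smul hs, neg_one_mul,
    ← sub_eq_add_neg]

theorem norm_sub_add_I_mul_sub_le {a b c d : ℂ} (ha : 0 ≤ a) (hb : 0 ≤ b) (hc : 0 ≤ c)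
    (hd : 0 ≤ d) : ‖a - b + Complex.I * c - Complex.I * d‖ ≤ ‖a + b + c + d‖ := by
  have hsum : ‖a + b + c + d‖ = ‖a‖ + ‖b‖ + ‖c‖ + ‖d‖ := by
    have h0 : 0 ≤ a + b + c + d := add_nonneg (add_nonneg (add_nonneg ha hb) hc) hd
    apply Complex.ofReal_injective
    push_cast
    simp only [Complex.norm_of_nonneg', *]
  calc ‖a - b + Complex.I * c - Complex.I * d‖
      ≤ ‖a‖ + ‖b‖ + ‖Complex.I * c‖ + ‖Complex.I * d‖ :=
        norm_sub_le_of_le (norm_add_le_of_le (norm_sub_le a b) le_rfl) le_rfl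
    _ = ‖a + b + c + d‖ := by simp [hsum]

theorem norm_stateFun_le_of_mem_posDecomp (hs : IsState s) {F : Fin 4 → X → (K →L[ℂ] K)}
    (hF : F ∈ posDecomp f) (x : X) :
    ‖stateFun ν μ s f x‖ ≤ ‖stateFun ν μ s (F 0 + F 1 + F 2 + F 3) x‖ := by
  obtain ⟨-, h0, rfl⟩ := hF
  have hpos (k : Fin 4) : 0 ≤ stateFun ν μ s (F k) x := stateFun_nonneg hs (h0 k x)
  simp only [stateFun_sub hs, stateFun_add hs, stateFun_smul hs]
  exact norm_sub_add_I_mul_sub_le (hpos 0) (hpos 1) (hpos 2) (hpos 3)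

theorem eLpNorm_stateFun_le_pNorm (hs : IsState s) (p : ℝ) (f : X → (K →L[ℂ] K)) :
    eLpNorm (stateFun ν μ s f) (ENNReal.ofReal p) μ ≤ pNorm ν μ p f :=
  le_iInf₂ fun F hF => (eLpNorm_mono fun x => norm_stateFun_le_of_mem_posDecomp hs hF x).trans
    (le_iSup₂ (f := fun (s : K →L[ℂ] K) (_ : IsState s) =>
      eLpNorm (stateFun ν μ s (F 0 + F 1 + F 2 + F 3)) (ENNReal.ofReal p) μ) s hs)

theorem pNorm_le_of_nonneg (hf : f ∈ qrvSpan X K) (h0 : ∀ x, 0 ≤ f x) {p : ℝ} {c : ℝ≥0∞}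
    (hc : ∀ s, IsState s → eLpNorm (stateFun ν μ s f) (ENNReal.ofReal p) μ ≤ c) :
    pNorm ν μ p f ≤ c := by
  refine iInf₂_le_of_le ![f, 0, 0, 0] ⟨?_, ?_, by simp⟩ (by simpa using hc)
  · simp [Fin.forall_fin_succ, hf]
  · simpa [Fin.forall_fin_succ] using h0

theorem measurable_stateFun [TopologicalSpace.SeparableSpace K] (h : HasRNDeriv ν μ)
    (hs : IsState s) (hf : WeakMeasurable f) : Measurable (stateFun ν μ s f) := by
  have hD := (weakMeasurable_rnDeriv h).sqrt
  exact ((hD.mul hf).mul hD).isQRV s hs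

end StateFun

/-! ### Hölder's inequality for the separable norm -/

section SeparableNorm

variable {X : Type*} [MeasurableSpace X] {μ : Measure X}

theorem eLpNorm_mul_le_of_holderTriple {p q r : ℝ} (hpqr : p.HolderTriple q r) {a b : X → ℂ}
    (ha : AEStronglyMeasurable a μ) (hb : AEStronglyMeasurable b μ) :
    eLpNorm (fun x => a x * b x) (ENNReal.ofReal r) μ ≤
      eLpNorm a (ENNReal.ofReal p) μ * eLpNorm b (ENNReal.ofReal q) μ := by
  have := hpqr.ennrealOfReal
  simpa using eLpNorm_le_eLpNorm_mul_eLpNorm_of_nnnorm (r := ENNReal.ofReal r) ha hb (· * ·) 1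
    (.of_forall fun x => by simp)

section Convexity

variable {K : Type*} [NormedAddCommGroup K] [InnerProductSpace ℂ K] [CompleteSpace K]
  [TopologicalSpace.SeparableSpace K] {ν : POVM X K} {F : X → (K →L[ℂ] K)} {p : ℝ≥0∞}

theorem convex_eLpNorm_stateFun_le (hν : HasRNDeriv ν μ) (hF : WeakMeasurable F) (hp : 1 ≤ p)
    (c : ℝ≥0∞) : Convex ℝ {s | IsState s ∧ eLpNorm (stateFun ν μ s F) p μ ≤ c} := by
  rintro s ⟨hs, hsc⟩ t ⟨ht, htc⟩ a b ha hb hab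
  refine ⟨convex_isState hs ht ha hb hab, ?_⟩
  have hcomb : stateFun ν μ (a • s + b • t) F =
      a • stateFun ν μ s F + b • stateFun ν μ t F :=
    funext fun x => tr_convex_comb_mul hs ht ha hb hab _
  calc eLpNorm (stateFun ν μ (a • s + b • t) F) p μ
      ≤ eLpNorm (a • stateFun ν μ s F) p μ + eLpNorm (b • stateFun ν μ t F) p μ := by
        rw [hcomb]
        exact eLpNorm_add_le
          ((measurable_stateFun hν hs hF).const_smul a).aestronglyMeasurable
          ((measurable_stateFun hν ht hF).const_smul b).aestronglyMeasurable hp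
    _ ≤ ENNReal.ofReal a * c + ENNReal.ofReal b * c := by
        rw [eLpNorm_const_smul, eLpNorm_const_smul, Real.enorm_of_nonneg ha,
          Real.enorm_of_nonneg hb]
        gcongr
    _ = c := by rw [← add_mul, ← ENNReal.ofReal_add ha hb, hab, ENNReal.ofReal_one, one_mul]

theorem eLpNorm_stateFun_le_of_tendsto (hν : HasRNDeriv ν μ) (hF : WeakMeasurable F) {c : ℝ≥0∞}
    {t : ℕ → K →L[ℂ] K} {s : K →L[ℂ] K} (hs : IsState s) (ht : ∀ n, IsState (t n))
    (hts : ∀ v, Filter.Tendsto (fun n => ⟪v, t n v⟫_ℂ) Filter.atTop (nhds ⟪v, s v⟫_ℂ))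
    (hc : ∀ n, eLpNorm (stateFun ν μ (t n) F) p μ ≤ c) :
    eLpNorm (stateFun ν μ s F) p μ ≤ c :=
  calc eLpNorm (stateFun ν μ s F) p μ
      ≤ Filter.liminf (fun n => eLpNorm (stateFun ν μ (t n) F) p μ) Filter.atTop :=
        Lp.eLpNorm_lim_le_liminf_eLpNorm
          (fun n => (measurable_stateFun hν (ht n) hF).aestronglyMeasurable) _
          (.of_forall fun _ => tendsto_tr ht hs hts _)
    _ ≤ c := (Filter.liminf_le_liminf (.of_forall hc)).trans (Filter.liminf_const c).le

theorem eLpNorm_stateFun_le_of_mem_closure_convexHull (hν : HasRNDeriv ν μ)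
    (hF : WeakMeasurable F) (hp : 1 ≤ p) {c : ℝ≥0∞} {P : Set (K →L[ℂ] K)}
    (hP : ∀ t ∈ P, IsState t ∧ eLpNorm (stateFun ν μ t F) p μ ≤ c) {s : K →L[ℂ] K}
    (hs : IsState s) (hsP : s ∈ closure (convexHull ℝ P)) :
    eLpNorm (stateFun ν μ s F) p μ ≤ c := by
  obtain ⟨t, htP, hts⟩ := mem_closure_iff_seq_limit.1 hsP
  have ht (n : ℕ) := convexHull_min hP (convex_eLpNorm_stateFun_le hν hF hp c) (htP n)
  exact eLpNorm_stateFun_le_of_tendsto hν hF hs (fun n => (ht n).1)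
    (fun v => tendsto_const_nhds.inner
      (((ContinuousLinearMap.apply ℂ K v).continuous.tendsto s).comp hts))
    fun n => (ht n).2

end Convexity

variable {H₁ : Type*} [NormedAddCommGroup H₁] [InnerProductSpace ℂ H₁] [CompleteSpace H₁]
  [TopologicalSpace.SeparableSpace H₁]
variable {H₂ : Type*} [NormedAddCommGroup H₂] [InnerProductSpace ℂ H₂] [CompleteSpace H₂]
  [TopologicalSpace.SeparableSpace H₂]
variable {ν₁ : POVM X H₁} {ν₂ : POVM X H₂} {ν₁₂ : POVM X (HTensor H₁ H₂)}

theorem IsTensorPOVM.stateFun_funTensor_ae_eq (h : IsTensorPOVM μ ν₁ ν₂ ν₁₂)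
    (h₁ : HasRNDeriv ν₁ μ) (h₂ : HasRNDeriv ν₂ μ) (f : X → (H₁ →L[ℂ] H₁))
    (g : X → (H₂ →L[ℂ] H₂)) : ∀ᵐ x ∂μ, ∀ s, stateFun ν₁₂ μ s (funTensor f g) x =
      tr (s * opTensor (CFC.sqrt (rnDeriv ν₁ μ x) * f x * CFC.sqrt (rnDeriv ν₁ μ x))
        (CFC.sqrt (rnDeriv ν₂ μ x) * g x * CFC.sqrt (rnDeriv ν₂ μ x))) := by
  filter_upwards [h.rnDeriv_ae_eq h₁ h₂, (isRNDeriv_rnDeriv h₁).ae_nonneg,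
    (isRNDeriv_rnDeriv h₂).ae_nonneg] with x hx hx₁ hx₂ s
  rw [stateFun_eq_of_mul_self_eq (opTensor_nonneg (CFC.sqrt_nonneg (rnDeriv ν₁ μ x))
    (CFC.sqrt_nonneg (rnDeriv ν₂ μ x))), funTensor, opTensor_mul, opTensor_mul]
  rw [opTensor_mul, CFC.sqrt_mul_sqrt_self _ hx₁, CFC.sqrt_mul_sqrt_self _ hx₂, hx, funTensor]

theorem IsTensorPOVM.stateFun_opTensor_ae_eq (h : IsTensorPOVM μ ν₁ ν₂ ν₁₂)
    (h₁ : HasRNDeriv ν₁ μ) (h₂ : HasRNDeriv ν₂ μ) (f : X → (H₁ →L[ℂ] H₁))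
    (g : X → (H₂ →L[ℂ] H₂)) {s₁ : H₁ →L[ℂ] H₁} {s₂ : H₂ →L[ℂ] H₂} (hs₁ : IsState s₁)
    (hs₂ : IsState s₂) : stateFun ν₁₂ μ (opTensor s₁ s₂) (funTensor f g) =ᵐ[μ]
      fun x => stateFun ν₁ μ s₁ f x * stateFun ν₂ μ s₂ g x := by
  filter_upwards [h.stateFun_funTensor_ae_eq h₁ h₂ f g] with x hx
  rw [hx, tr_opTensor_mul hs₁ hs₂, stateFun, stateFun]

theorem IsTensorPOVM.sepNorm_funTensor_le (h : IsTensorPOVM μ ν₁ ν₂ ν₁₂)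
    (h₁ : HasRNDeriv ν₁ μ) (h₂ : HasRNDeriv ν₂ μ) {p q r : ℝ} (hpqr : p.HolderTriple q r)
    (hr : 1 ≤ r) {f : X → (H₁ →L[ℂ] H₁)} {g : X → (H₂ →L[ℂ] H₂)} (hf : WeakMeasurable f)
    (hg : WeakMeasurable g) :
    sepNorm ν₁₂ μ r (funTensor f g) ≤ pNorm ν₁ μ p f * pNorm ν₂ μ q g := by
  refine iSup₂_le fun s hs => eLpNorm_stateFun_le_of_mem_closure_convexHull
    (h.hasRNDeriv h₁ h₂) (hf.funTensor hg) (by simpa using hr) ?_ hs.1 hs.2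
  rintro _ ⟨s₁, s₂, hs₁, hs₂, rfl⟩
  refine ⟨hs₁.opTensor hs₂, ?_⟩
  calc eLpNorm (stateFun ν₁₂ μ (opTensor s₁ s₂) (funTensor f g)) (ENNReal.ofReal r) μ
      = eLpNorm (fun x => stateFun ν₁ μ s₁ f x * stateFun ν₂ μ s₂ g x) (ENNReal.ofReal r) μ :=
        eLpNorm_congr_ae (h.stateFun_opTensor_ae_eq h₁ h₂ f g hs₁ hs₂)
    _ ≤ eLpNorm (stateFun ν₁ μ s₁ f) (ENNReal.ofReal p) μ *
          eLpNorm (stateFun ν₂ μ s₂ g) (ENNReal.ofReal q) μ :=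
        eLpNorm_mul_le_of_holderTriple hpqr (measurable_stateFun h₁ hs₁ hf).aestronglyMeasurable
          (measurable_stateFun h₂ hs₂ hg).aestronglyMeasurable
    _ ≤ pNorm ν₁ μ p f * pNorm ν₂ μ q g :=
        mul_le_mul' (eLpNorm_stateFun_le_pNorm hs₁ p f) (eLpNorm_stateFun_le_pNorm hs₂ q g)

end SeparableNorm

/-! ### Positive operator matrices -/

section BlockPositivity

variable {ι κ : Type*}

section Gram

variable {K : Type*} [NormedAddCommGroup K] [InnerProductSpace ℂ K] {S T R : K →L[ℂ] K}

/-- The Gram matrix of the vectors `(a i, 0)` and `(0, c j)` of `K ⊕ K` for the form given by the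
operator matrix `[[S, T], [T*, R]]`. -/
def blockGram (S T R : K →L[ℂ] K) (a : ι → K) (c : κ → K) : Matrix (ι ⊕ κ) (ι ⊕ κ) ℂ :=
  Matrix.fromBlocks (.of fun i j => ⟪a i, S (a j)⟫_ℂ) (.of fun i j => ⟪a i, T (c j)⟫_ℂ)
    (.of fun i j => ⟪T (c i), a j⟫_ℂ) (.of fun i j => ⟪c i, R (c j)⟫_ℂ)

theorem isHermitian_blockGram (hS : 0 ≤ S) (hR : 0 ≤ R) (a : ι → K) (c : κ → K) :
    (blockGram S T R a c).IsHermitian := by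
  refine Matrix.IsHermitian.fromBlocks ?_ ?_ ?_ <;> ext i j
  · simp [inner_map_of_nonneg hS]
  · simp
  · simp [inner_map_of_nonneg hR]

variable [CompleteSpace K]

theorem BlockPos.nonneg_left (h : BlockPos S T R) : 0 ≤ S :=
  nonneg_iff_forall_inner_nonneg.2 fun u => by simpa using h u 0

theorem BlockPos.nonneg_right (h : BlockPos S T R) : 0 ≤ R :=
  nonneg_iff_forall_inner_nonneg.2 fun v => by simpa using h 0 v

theorem star_dotProduct_blockGram_mulVec [Fintype ι] [Fintype κ] (a : ι → K) (c : κ → K)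
    (x : ι ⊕ κ → ℂ) :
    star x ⬝ᵥ Matrix.mulVec (blockGram S T R a c) x =
      ⟪∑ i, x (.inl i) • a i, S (∑ i, x (.inl i) • a i) + T (∑ j, x (.inr j) • c j)⟫_ℂ +
      ⟪∑ j, x (.inr j) • c j, (T†) (∑ i, x (.inl i) • a i) + R (∑ j, x (.inr j) • c j)⟫_ℂ := by
  simp only [dotProduct, Matrix.mulVec, Fintype.sum_sum_type, blockGram,
    Matrix.fromBlocks_apply₁₁, Matrix.fromBlocks_apply₁₂, Matrix.fromBlocks_apply₂₁,
    Matrix.fromBlocks_apply₂₂, Matrix.of_apply, inner_add_right,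
    ContinuousLinearMap.adjoint_inner_right, map_sum, map_smul, sum_inner, inner_sum,
    inner_smul_left, inner_smul_right, Pi.star_apply, RCLike.star_def, Finset.mul_sum, mul_add,
    Finset.sum_add_distrib]
  rw [add_add_add_comm]
  congr 2 <;> (rw [Finset.sum_comm]; simp only [mul_assoc, mul_comm])

theorem BlockPos.posSemidef_blockGram [Finite ι] [Finite κ] (h : BlockPos S T R) (a : ι → K)
    (c : κ → K) : (blockGram S T R a c).PosSemidef := by
  have := Fintype.ofFinite ι
  have := Fintype.ofFinite κ
  refine Matrix.posSemidef_iff_dotProduct_mulVec.2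
    ⟨isHermitian_blockGram h.nonneg_left h.nonneg_right a c, fun x => ?_⟩
  rw [star_dotProduct_blockGram_mulVec]
  exact h _ _

end Gram

variable {H₁ : Type*} [NormedAddCommGroup H₁] [InnerProductSpace ℂ H₁]
variable {H₂ : Type*} [NormedAddCommGroup H₂] [InnerProductSpace ℂ H₂]
variable {S₁ T₁ R₁ : H₁ →L[ℂ] H₁} {S₂ T₂ R₂ : H₂ →L[ℂ] H₂}

theorem blockGram_opTensor (a : ι → H₁) (b : ι → H₂) (c : κ → H₁) (d : κ → H₂) :
    blockGram (opTensor S₁ S₂) (opTensor T₁ T₂) (opTensor R₁ R₂) (fun i => htmul (a i) (b i))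
        (fun j => htmul (c j) (d j)) =
      (blockGram S₁ T₁ R₁ a c).hadamard (blockGram S₂ T₂ R₂ b d) := by
  ext (i | i) (j | j) <;> simp [blockGram, opTensor_htmul, inner_htmul]

theorem exists_coe_eq_sum_htmul (z : H₁ ⊗[ℂ] H₂) :
    ∃ P : Finset (H₁ × H₂), (z : HTensor H₁ H₂) = ∑ q : P, htmul q.1.1 q.1.2 := by
  obtain ⟨P, rfl⟩ := TensorProduct.exists_finset z
  refine ⟨P, ?_⟩
  rw [Finset.sum_coe_sort P fun q => htmul q.1 q.2]
  exact map_sum (UniformSpace.Completion.toComplL (𝕜 := ℂ) (E := H₁ ⊗[ℂ] H₂)) _ P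

theorem BlockPos.opTensor [CompleteSpace H₁] [CompleteSpace H₂] (h₁ : BlockPos S₁ T₁ R₁)
    (h₂ : BlockPos S₂ T₂ R₂) :
    BlockPos (opTensor S₁ S₂) (opTensor T₁ T₂) (opTensor R₁ R₂) := by
  intro u v
  induction u, v using UniformSpace.Completion.induction_on₂ with
  | hp => exact isClosed_le (by fun_prop) (by fun_prop)
  | ih u v =>
    obtain ⟨P, hu⟩ := exists_coe_eq_sum_htmul u
    obtain ⟨Q, hv⟩ := exists_coe_eq_sum_htmul v
    have hSchur := (h₁.posSemidef_blockGram (fun q : P => q.1.1) (fun q : Q => q.1.1)).hadamard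
      (h₂.posSemidef_blockGram (fun q : P => q.1.2) (fun q : Q => q.1.2))
    have hpos := hSchur.dotProduct_mulVec_nonneg fun _ => 1
    rw [← blockGram_opTensor, star_dotProduct_blockGram_mulVec] at hpos
    simpa only [one_smul, ← hu, ← hv] using hpos

end BlockPositivity

/-! ### Hölder's inequality for the decomposable norm -/

section DecomposableNorm

variable {X : Type*} [MeasurableSpace X] {μ : Measure X}

section General

variable {K : Type*} [NormedAddCommGroup K] [InnerProductSpace ℂ K] [CompleteSpace K]
variable {ν : POVM X K} {f : X → (K →L[ℂ] K)}

theorem blockPos_add_sub_I_smul_sub {A B C D : K →L[ℂ] K} (hA : 0 ≤ A) (hB : 0 ≤ B) (hC : 0 ≤ C)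
    (hD : 0 ≤ D) : BlockPos (A + B + C + D) (A - B + Complex.I • C - Complex.I • D)
      (A + B + C + D) := by
  intro u v
  -- The matrices `[[1, c], [conj c, 1]]` with `c = 1, -1, i, -i` are positive of rank one.
  have hsplit : ⟪u, (A + B + C + D) u + (A - B + Complex.I • C - Complex.I • D) v⟫_ℂ +
      ⟪v, ((A - B + Complex.I • C - Complex.I • D)†) u + (A + B + C + D) v⟫_ℂ =
      ⟪u + v, A (u + v)⟫_ℂ + ⟪u - v, B (u - v)⟫_ℂ +
      ⟪u + Complex.I • v, C (u + Complex.I • v)⟫_ℂ +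
      ⟪u - Complex.I • v, D (u - Complex.I • v)⟫_ℂ := by
    simp only [inner_add_right, ContinuousLinearMap.adjoint_inner_right, add_apply, sub_apply,
      smul_apply, inner_add_left, inner_sub_left, inner_sub_right, inner_smul_left,
      inner_smul_right, map_add, map_sub, map_smul, Complex.conj_I, inner_map_of_nonneg hA,
      inner_map_of_nonneg hB, inner_map_of_nonneg hC, inner_map_of_nonneg hD]
    linear_combination (⟪v, C v⟫_ℂ + ⟪v, D v⟫_ℂ) * Complex.I_sq
  rw [hsplit]
  have hpos {A : K →L[ℂ] K} (hA : 0 ≤ A) := nonneg_iff_forall_inner_nonneg.1 hA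
  exact add_nonneg (add_nonneg (add_nonneg (hpos hA _) (hpos hB _)) (hpos hC _)) (hpos hD _)

theorem decNorm_le_pNorm (p : ℝ) (f : X → (K →L[ℂ] K)) : decNorm ν μ p f ≤ pNorm ν μ p f := by
  refine le_iInf₂ fun F ⟨hFspan, hF0, hf⟩ => ?_
  set S := F 0 + F 1 + F 2 + F 3
  have hblock (x : X) : BlockPos (S x) (f x) (S x) := by
    rw [hf]
    exact blockPos_add_sub_I_smul_sub (hF0 0 x) (hF0 1 x) (hF0 2 x) (hF0 3 x)
  have hSspan : S ∈ qrvSpan X K :=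
    add_mem (add_mem (add_mem (hFspan 0) (hFspan 1)) (hFspan 2)) (hFspan 3)
  have hS0 (x : X) : 0 ≤ S x := (hblock x).nonneg_left
  calc decNorm ν μ p f ≤ max (pNorm ν μ p S) (pNorm ν μ p S) :=
        iInf_le_of_le S (iInf₂_le S ⟨hSspan, hSspan, hS0, hS0, .of_forall hblock⟩)
    _ = pNorm ν μ p S := max_self _
    _ ≤ ⨆ (s : K →L[ℂ] K) (_ : IsState s), eLpNorm (stateFun ν μ s S) (ENNReal.ofReal p) μ :=
        pNorm_le_of_nonneg hSspan hS0 fun s hs =>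
          le_iSup₂ (f := fun (s : K →L[ℂ] K) (_ : IsState s) =>
            eLpNorm (stateFun ν μ s S) (ENNReal.ofReal p) μ) s hs

theorem exists_of_decNorm_lt {p : ℝ} {c : ℝ≥0∞} (h : decNorm ν μ p f < c) :
    ∃ S ∈ lpSpace ν μ p, ∃ R ∈ lpSpace ν μ p, (∀ x, 0 ≤ S x) ∧ (∀ x, 0 ≤ R x) ∧
      (∀ᵐ x ∂μ, BlockPos (S x) (f x) (R x)) ∧ pNorm ν μ p S < c ∧ pNorm ν μ p R < c := by
  simp only [decNorm, iInf_lt_iff, max_lt_iff] at h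
  obtain ⟨S, R, ⟨hS, hR, hS0, hR0, hblock⟩, hSc, hRc⟩ := h
  exact ⟨S, ⟨hS, hSc.trans_le le_top⟩, R, ⟨hR, hRc.trans_le le_top⟩, hS0, hR0, hblock, hSc, hRc⟩

end General

variable {H₁ : Type*} [NormedAddCommGroup H₁] [InnerProductSpace ℂ H₁] [CompleteSpace H₁]
  [TopologicalSpace.SeparableSpace H₁]
variable {H₂ : Type*} [NormedAddCommGroup H₂] [InnerProductSpace ℂ H₂] [CompleteSpace H₂]
  [TopologicalSpace.SeparableSpace H₂]
variable {ν₁ : POVM X H₁} {ν₂ : POVM X H₂} {ν₁₂ : POVM X (HTensor H₁ H₂)}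
variable {f S : X → (H₁ →L[ℂ] H₁)} {g T : X → (H₂ →L[ℂ] H₂)} {p q r : ℝ}

theorem funTensor_mem_qrvSpan (hS : S ∈ qrvSpan X H₁) (hT : T ∈ qrvSpan X H₂)
    (hS0 : ∀ x, 0 ≤ S x) (hT0 : ∀ x, 0 ≤ T x) : funTensor S T ∈ qrvSpan X (HTensor H₁ H₂) :=
  ((WeakMeasurable.of_mem_qrvSpan hS).funTensor (.of_mem_qrvSpan hT)).mem_qrvSpan
    fun x => opTensor_nonneg (hS0 x) (hT0 x)

theorem IsTensorPOVM.sepDecNorm_funTensor_le (h : IsTensorPOVM μ ν₁ ν₂ ν₁₂)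
    (h₁ : HasRNDeriv ν₁ μ) (h₂ : HasRNDeriv ν₂ μ) (hpqr : p.HolderTriple q r) (hr : 1 ≤ r)
    (hf : decNorm ν₁ μ p f ≠ ∞) (hg : decNorm ν₂ μ q g ≠ ∞)
    {C : Set (X → (HTensor H₁ H₂ →L[ℂ] HTensor H₁ H₂))}
    (hC : ∀ S ∈ lpSpace ν₁ μ p, ∀ T ∈ lpSpace ν₂ μ q, (∀ x, 0 ≤ S x) → (∀ x, 0 ≤ T x) →
      funTensor S T ∈ C) :
    sepDecNorm C ν₁₂ μ r (funTensor f g) ≤ decNorm ν₁ μ p f * decNorm ν₂ μ q g := by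
  refine ENNReal.le_mul_of_forall_lt (.inr hg) (.inl hf) fun a ha b hb => ?_
  obtain ⟨S₁, hS₁, R₁, hR₁, hS₁0, hR₁0, hblock₁, hSa, hRa⟩ := exists_of_decNorm_lt ha
  obtain ⟨S₂, hS₂, R₂, hR₂, hS₂0, hR₂0, hblock₂, hSb, hRb⟩ := exists_of_decNorm_lt hb
  have hblock : ∀ᵐ x ∂μ, BlockPos (funTensor S₁ S₂ x) (funTensor f g x) (funTensor R₁ R₂ x) := by
    filter_upwards [hblock₁, hblock₂] with x hx₁ hx₂ using hx₁.opTensor hx₂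
  have hle {S : X → (H₁ →L[ℂ] H₁)} {T : X → (H₂ →L[ℂ] H₂)} (hS : S ∈ qrvSpan X H₁)
      (hT : T ∈ qrvSpan X H₂) (hSa : pNorm ν₁ μ p S < a) (hTb : pNorm ν₂ μ q T < b) :
      sepNorm ν₁₂ μ r (funTensor S T) ≤ a * b :=
    (h.sepNorm_funTensor_le h₁ h₂ hpqr hr (.of_mem_qrvSpan hS) (.of_mem_qrvSpan hT)).trans
      (mul_le_mul' hSa.le hTb.le)
  exact iInf_le_of_le (funTensor S₁ S₂) <| iInf₂_le_of_le (funTensor R₁ R₂)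
    ⟨hC S₁ hS₁ S₂ hS₂ hS₁0 hS₂0, hC R₁ hR₁ R₂ hR₂ hR₁0 hR₂0,
      fun x => opTensor_nonneg (hS₁0 x) (hS₂0 x), fun x => opTensor_nonneg (hR₁0 x) (hR₂0 x),
      hblock⟩
    (max_le (hle hS₁.1 hS₂.1 hSa hSb) (hle hR₁.1 hR₂.1 hRa hRb))

end DecomposableNorm

/-! ### Tensor products of `L^p` functions in finite dimension -/

section FiniteDimensional

variable {X : Type*} [MeasurableSpace X] {μ : Measure X} {ι : Type*} [Fintype ι]

section General

variable {K : Type*} [NormedAddCommGroup K] [InnerProductSpace ℂ K] [CompleteSpace K]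
variable {ν : POVM X K} {f : X → (K →L[ℂ] K)} {x : X}

theorem norm_le_norm_sum_inner {A : K →L[ℂ] K} (hA : 0 ≤ A) (b : OrthonormalBasis ι ℂ K) :
    ‖A‖ ≤ ‖∑ i, ⟪b i, A (b i)⟫_ℂ‖ := by
  have hsum : 0 ≤ ∑ i, ⟪b i, A (b i)⟫_ℂ :=
    Finset.sum_nonneg fun i _ => nonneg_iff_forall_inner_nonneg.1 hA (b i)
  refine norm_le_of_hasSum_inner hA b.toHilbertBasis ?_
  simpa only [OrthonormalBasis.coe_toHilbertBasis, Complex.norm_of_nonneg' hsum] using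
    hasSum_fintype fun i => ⟪b i, A (b i)⟫_ℂ

theorem norm_sqrt_mul_mul_sqrt_le (hf : 0 ≤ f x) (b : OrthonormalBasis ι ℂ K) :
    ‖CFC.sqrt (rnDeriv ν μ x) * f x * CFC.sqrt (rnDeriv ν μ x)‖ ≤
      ‖∑ i, stateFun ν μ (InnerProductSpace.rankOne ℂ (b i) (b i)) f x‖ := by
  simp only [stateFun, tr_rankOne_mul (b.orthonormal.1 _)]
  have hsqrt : 0 ≤ CFC.sqrt (rnDeriv ν μ x) := CFC.sqrt_nonneg (rnDeriv ν μ x)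
  exact norm_le_norm_sum_inner (conjugate_nonneg_of_nonneg hf hsqrt) b

theorem memLp_sum_stateFun_rankOne [TopologicalSpace.SeparableSpace K] (hν : HasRNDeriv ν μ)
    {p : ℝ} (hf : f ∈ lpSpace ν μ p) (b : OrthonormalBasis ι ℂ K) :
    MemLp (fun x => ∑ i, stateFun ν μ (InnerProductSpace.rankOne ℂ (b i) (b i)) f x)
      (ENNReal.ofReal p) μ := by
  refine memLp_finsetSum _ fun i _ => ?_
  have hs := isState_rankOne (b.orthonormal.1 i)
  exact ⟨(measurable_stateFun hν hs (.of_mem_qrvSpan hf.1)).aestronglyMeasurable,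
    (eLpNorm_stateFun_le_pNorm hs p f).trans_lt hf.2⟩

end General

variable {H₁ : Type*} [NormedAddCommGroup H₁] [InnerProductSpace ℂ H₁] [CompleteSpace H₁]
  [FiniteDimensional ℂ H₁]
variable {H₂ : Type*} [NormedAddCommGroup H₂] [InnerProductSpace ℂ H₂] [CompleteSpace H₂]
  [FiniteDimensional ℂ H₂]
variable {ν₁ : POVM X H₁} {ν₂ : POVM X H₂} {ν₁₂ : POVM X (HTensor H₁ H₂)}
variable {S : X → (H₁ →L[ℂ] H₁)} {T : X → (H₂ →L[ℂ] H₂)} {p q r : ℝ}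

theorem IsTensorPOVM.funTensor_mem_lpSpace (h : IsTensorPOVM μ ν₁ ν₂ ν₁₂)
    (h₁ : HasRNDeriv ν₁ μ) (h₂ : HasRNDeriv ν₂ μ) (hpqr : p.HolderTriple q r)
    (hS : S ∈ lpSpace ν₁ μ p) (hT : T ∈ lpSpace ν₂ μ q) (hS0 : ∀ x, 0 ≤ S x)
    (hT0 : ∀ x, 0 ≤ T x) : funTensor S T ∈ lpSpace ν₁₂ μ r := by
  let b₁ := stdOrthonormalBasis ℂ H₁
  let b₂ := stdOrthonormalBasis ℂ H₂
  have hspan := funTensor_mem_qrvSpan hS.1 hT.1 hS0 hT0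
  have hSp := memLp_sum_stateFun_rankOne h₁ hS b₁
  have hTq := memLp_sum_stateFun_rankOne h₂ hT b₂
  refine ⟨hspan, (pNorm_le_of_nonneg hspan (fun x => opTensor_nonneg (hS0 x) (hT0 x))
    fun s hs => ?_).trans_lt (ENNReal.mul_lt_top hSp.2 hTq.2)⟩
  refine (eLpNorm_mono_ae ?_).trans (eLpNorm_mul_le_of_holderTriple hpqr hSp.1 hTq.1)
  filter_upwards [h.stateFun_funTensor_ae_eq h₁ h₂ S T] with x hx
  rw [hx, norm_mul]
  calc _ ≤ _ := hs.norm_tr_le _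
    _ ≤ _ := norm_opTensor_le _ _
    _ ≤ _ := mul_le_mul (norm_sqrt_mul_mul_sqrt_le (hS0 x) b₁)
      (norm_sqrt_mul_mul_sqrt_le (hT0 x) b₂) (norm_nonneg _) (norm_nonneg _)

end FiniteDimensional

end QRV

end

theorem mainTheorem6_general
    {H₁ : Type*} [NormedAddCommGroup H₁] [InnerProductSpace ℂ H₁] [CompleteSpace H₁]
    [TopologicalSpace.SeparableSpace H₁]
    {H₂ : Type*} [NormedAddCommGroup H₂] [InnerProductSpace ℂ H₂] [CompleteSpace H₂]
    [TopologicalSpace.SeparableSpace H₂]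
    {X : Type*} [MeasurableSpace X] (μ : Measure X) (ν₁ : QRV.POVM X H₁) (ν₂ : QRV.POVM X H₂)
    (hν₁ : QRV.HasRNDeriv ν₁ μ) (hν₂ : QRV.HasRNDeriv ν₂ μ)
    (ν₁₂ : QRV.POVM X (QRV.HTensor H₁ H₂)) (hν₁₂ : QRV.IsTensorPOVM μ ν₁ ν₂ ν₁₂)
    (p q r : ℝ) (hpqr : p.HolderTriple q r) (hr : 1 ≤ r)
    (f : X → (H₁ →L[ℂ] H₁)) (g : X → (H₂ →L[ℂ] H₂))
    (hf : f ∈ QRV.lpSpace ν₁ μ p) (hg : g ∈ QRV.lpSpace ν₂ μ q) :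
    QRV.sepNorm ν₁₂ μ r (QRV.funTensor f g) ≤ QRV.pNorm ν₁ μ p f * QRV.pNorm ν₂ μ q g ∧
    QRV.sepDecNorm (QRV.qrvSpan X (QRV.HTensor H₁ H₂)) ν₁₂ μ r (QRV.funTensor f g) ≤
        QRV.decNorm ν₁ μ p f * QRV.decNorm ν₂ μ q g ∧
    (FiniteDimensional ℂ H₁ → FiniteDimensional ℂ H₂ →
      QRV.sepDecNorm (QRV.lpSpace ν₁₂ μ r) ν₁₂ μ r (QRV.funTensor f g) ≤
        QRV.decNorm ν₁ μ p f * QRV.decNorm ν₂ μ q g) := by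
  have hf_dec : QRV.decNorm ν₁ μ p f ≠ ∞ := ((QRV.decNorm_le_pNorm p f).trans_lt hf.2).ne
  have hg_dec : QRV.decNorm ν₂ μ q g ≠ ∞ := ((QRV.decNorm_le_pNorm q g).trans_lt hg.2).ne
  refine ⟨hν₁₂.sepNorm_funTensor_le hν₁ hν₂ hpqr hr (.of_mem_qrvSpan hf.1) (.of_mem_qrvSpan hg.1),
    ?_, fun _ _ => ?_⟩
  · exact hν₁₂.sepDecNorm_funTensor_le hν₁ hν₂ hpqr hr hf_dec hg_dec
      fun S hS T hT hS0 hT0 => QRV.funTensor_mem_qrvSpan hS.1 hT.1 hS0 hT0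
  · exact hν₁₂.sepDecNorm_funTensor_le hν₁ hν₂ hpqr hr hf_dec hg_dec
      fun S hS T hT hS0 hT0 => hν₁₂.funTensor_mem_lpSpace hν₁ hν₂ hpqr hS hT hS0 hT0

theorem mainTheorem6
    {H : Type*} [NormedAddCommGroup H] [InnerProductSpace ℂ H] [CompleteSpace H]
    [TopologicalSpace.SeparableSpace H]
    {X : Type*} [TopologicalSpace X] [T2Space X] [LocallyCompactSpace X]
    [MeasurableSpace X] [BorelSpace X]
    (ν : QRV.POVM X H) (ρ : H →L[ℂ] H) (hρ : QRV.IsState ρ) (hρ_inj : Function.Injective ρ)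
    (hν : QRV.HasRNDeriv ν (ν.scalarMeasure ρ hρ))
    (νν : QRV.POVM X (QRV.HTensor H H))
    (hνν : QRV.IsTensorPOVM (ν.scalarMeasure ρ hρ) ν ν νν)
    (p q : ℝ) (hpq : p.HolderConjugate q)
    (f g : X → (H →L[ℂ] H))
    (hf : f ∈ QRV.lpSpace ν (ν.scalarMeasure ρ hρ) p)
    (hg : g ∈ QRV.lpSpace ν (ν.scalarMeasure ρ hρ) q) :
    QRV.sepNorm νν (ν.scalarMeasure ρ hρ) 1 (QRV.funTensor f g) ≤
        QRV.pNorm ν (ν.scalarMeasure ρ hρ) p f * QRV.pNorm ν (ν.scalarMeasure ρ hρ) q g ∧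
    QRV.sepDecNorm (QRV.qrvSpan X (QRV.HTensor H H)) νν (ν.scalarMeasure ρ hρ) 1
          (QRV.funTensor f g) ≤
        QRV.decNorm ν (ν.scalarMeasure ρ hρ) p f * QRV.decNorm ν (ν.scalarMeasure ρ hρ) q g ∧
    (FiniteDimensional ℂ H →
      QRV.sepDecNorm (QRV.lpSpace νν (ν.scalarMeasure ρ hρ) 1) νν (ν.scalarMeasure ρ hρ) 1
          (QRV.funTensor f g) ≤
        QRV.decNorm ν (ν.scalarMeasure ρ hρ) p f * QRV.decNorm ν (ν.scalarMeasure ρ hρ) q g) := by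
  have hgeneral := mainTheorem6_general _ ν ν hν hν νν hνν p q 1 hpq le_rfl f g hf hg
  exact ⟨hgeneral.1, hgeneral.2.1, fun hH => hgeneral.2.2 hH hH⟩
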